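/- For a finite set $\Sigma$ with the discrete topology, let $\mathrm{Aut}(\Sigma^{\mathbb Z})$ be the group of all homeomorphisms of $\Sigma^{\mathbb Z}$ (product topology) that commute with the shift $\sigma(x)_i = x_{i+1}$, i.e. the group of reversible cellular automata over $\Sigma$. Let $\mathcal G$ be the class of all groups that are isomorphic to a subgroup of $\mathrm{Aut}(\Sigma^{\mathbb Z})$, where $\Sigma$ is a finite set with at least two elements; $\mathcal G$ does not depend on the choice of $\Sigma$. For a simple undirected graph $\Gamma = (V,E)$ and groups $(G_v)_{v \in V}$, the graph product $\overline G^{\Gamma}$ is the quotient of the free product of the groups $G_v$ by the normal closure of all commutators $[a,b]$ with $a \in G_i$, $b \in G_j$, $\{i,j\} \in E$. **Theorem.** The class $\mathcal G$ is closed under countable graph products: if $\Gamma = (V,E)$ is a graph with $V$ finite or countably infinite and $G_v \in \mathcal G$ for every $v \in V$, then $\overline G^{\Gamma} \in \mathcal G$. In detail, if for every $v \in V$ the group $G_v$ embeds in $\mathrm{Aut}(\Sigma_v^{\mathbb Z})$ for some finite alphabet $\Sigma_v$, then $\overline G^{\Gamma}$ embeds in $\mathrm{Aut}(\Sigma^{\mathbb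 Z})$ for every finite alphabet $\Sigma$ with at least two elements. -/

import Mathlib

/-- The automorphism group `Aut(A^ℤ)` of the two-sided full shift over the alphabet `A`: the group,
under composition, of the homeomorphisms of `ℤ → A` (product topology) that commute with the shift
`σ(x)_i = x_{i+1}`. For a finite discrete alphabet these are the reversible cellular automata:
the cellular automata that have a two-sided inverse cellular automaton. -/
def FullShiftAut (A : Type*) [TopologicalSpace A] : Subgroup ((ℤ → A) ≃ₜ (ℤ → A)) where
  carrier := {f | ∀ x : ℤ → A,
    f (SymbolicDynamics.FullShift.shift 1 x) = SymbolicDynamics.FullShift.shift 1 (f x)}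
  one_mem' := fun _ => rfl
  mul_mem' := by
    intro f g hf hg x
    change f (g _) = SymbolicDynamics.FullShift.shift 1 (f (g x))
    rw [hg, hf]
  inv_mem' := by
    intro f hf x
    change f.symm _ = SymbolicDynamics.FullShift.shift 1 (f.symm x)
    rw [Homeomorph.symm_apply_eq, hf, Homeomorph.apply_symm_apply]

/-- `G` is isomorphic to a subgroup of `Aut(A^ℤ)`, that is, there is an injective group
homomorphism from `G` to `Aut(A^ℤ)`. -/
def EmbedsInFullShiftAut (A : Type*) [TopologicalSpace A] (G : Type*) [Group G] : Prop :=
  ∃ φ : G →* FullShiftAut A, Function.Injective φ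

open scoped commutatorElement in
/-- The relators of the graph product, in the free product of the node groups: the commutators
`[a, b]` with `a ∈ G i` and `b ∈ G j`, for all edges `{i, j}` of `Γ`. -/
def graphProductRelators {V : Type*} (Γ : SimpleGraph V) (G : V → Type*) [∀ v, Group (G v)] :
    Set (Monoid.CoprodI G) :=
  {x | ∃ i j : V, Γ.Adj i j ∧ ∃ (a : G i) (b : G j),
    x = ⁅(Monoid.CoprodI.of a : Monoid.CoprodI G), (Monoid.CoprodI.of b : Monoid.CoprodI G)⁆}

/-- The graph product `⟨G_v (v ∈ V) ∣ [G_i, G_j] for all edges {i, j}⟩` of the node groups `G v`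
along the graph `Γ`: the quotient of their free product by the normal closure of the relators. -/
def GraphProduct {V : Type*} (Γ : SimpleGraph V) (G : V → Type*) [∀ v, Group (G v)] : Type _ :=
  Monoid.CoprodI G ⧸ Subgroup.normalClosure (graphProductRelators Γ G)

instance {V : Type*} (Γ : SimpleGraph V) (G : V → Type*) [∀ v, Group (G v)] :
    Group (GraphProduct Γ G) :=
  inferInstanceAs
    (Group (Monoid.CoprodI G ⧸ Subgroup.normalClosure (graphProductRelators Γ G)))

/-! Fix two letters `on` and `off` of `B`. Every vertex `v` gets its own code words ("cells") over
these letters, each carrying two symbols of `A v` and a fixed reference symbol, and two cells never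
overlap partially. A run of consecutive cells of type `v` is a conveyor belt: reading the top track
to the right and the bottom track to the left gives a cyclic or bi-infinite sequence over `A v`, on
which an automorphism of the full shift over `A v` acts. Cells keep their types and positions, so
this is a homomorphism `beltHom` into `Aut(B^ℤ)`.

Belts of different types interact only through signals. The next-to-last letter of a cell tells
whether its top symbol equals the reference symbol, and a cell with no live cell of its own type
directly before it joins a belt only if this signal is on. When cells of adjacent types touch, the
one of larger rank is dead. Hence rewriting cells of type `v` never switches cells of an adjacent
type (`active_overwrite_iff`), so adjacent vertex groups commute (`onBelts_comm`) and the
homomorphisms extend to the graph product. Since only the finitely many types of smaller rank can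
kill a cell, the maps stay continuous even for infinite `V`.

For injectivity, represent an element by a reduced word and read it from the right, tracking two
configurations whose final signals start to differ at some moment. A syllable whose type is adjacent
to that of the last segment leaves its signal alone. A syllable `(v, f)` with `v` different from and
not adjacent to that type is served by a new segment of `m` cells of type `v`, with `m` least such
that `f` moves a point of period `2m`. With the signal on, the whole segment is a cyclic belt of
length `2m`, and `f` changes the final top symbol; with the signal off, the belt has length `2(m-1)`
and `f` fixes it. So the difference is passed on (`exists_extension`). Reducedness excludes the
remaining case, a syllable of the type of the last segment (`exists_signals_ne`). -/

/-- The content of a cell on a conveyor belt over `A`: the symbols on the top track (`true`) and on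
the bottom track (`false`), and a reference symbol that is never rewritten. -/
abbrev BeltCell (A : Type*) := (Bool → A) × A

/-- A coding of cells of countably many types `v : V` by words over `B` that cannot overlap. The
next-to-last letter of a code word signals whether the top symbol is the reference symbol. -/
structure CellCode (V : Type*) (A : V → Type*) (B : Type*) where
  rank : V → ℕ
  rank_injective : Function.Injective rank
  len : V → ℤ
  two_le_len : ∀ v, 2 ≤ len v
  on : B
  off : B
  on_ne_off : on ≠ off
  code : ∀ v, BeltCell (A v) → ℤ → B
  code_zero : ∀ v c, code v c 0 = on
  code_one : ∀ v c, code v c 1 = on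
  code_last : ∀ v c, code v c (len v - 1) = off
  code_signal : ∀ v c, code v c (len v - 2) = on ↔ c.1 true = c.2
  eq_of_overlap : ∀ {v u : V} {c : BeltCell (A v)} {d : BeltCell (A u)} {s : ℤ}, 0 ≤ s → s < len v →
    (∀ k, s ≤ k → k < len v → k < s + len u → code v c k = code u d (k - s)) → s = 0 ∧ v = u
  code_injective : ∀ {v : V} {c d : BeltCell (A v)},
    (∀ k, 0 ≤ k → k < len v → code v c k = code v d k) → c = d

/-! ### Cells in a configuration and their simultaneous rewriting. -/

namespace CellCode

variable {V : Type*} {A : V → Type*} {B : Type*} (κ : CellCode V A B)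

/-- The code word of the cell `c` of type `v` occurs in `x` at position `i`. -/
def Occurs (x : ℤ → B) (v : V) (i : ℤ) (c : BeltCell (A v)) : Prop :=
  ∀ k, 0 ≤ k → k < κ.len v → x (i + k) = κ.code v c k

/-- Some cell of type `v` occurs in `x` at position `i`. -/
def HasCell (x : ℤ → B) (v : V) (i : ℤ) : Prop := ∃ c, κ.Occurs x v i c

variable {κ} {x y z : ℤ → B} {v u : V} {i j : ℤ} {c d : BeltCell (A v)}

theorem Occurs.apply (h : κ.Occurs x v i c) (h₁ : i ≤ j) (h₂ : j < i + κ.len v) :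
    x j = κ.code v c (j - i) := by
  have := h (j - i) (by omega) (by omega)
  rwa [add_sub_cancel] at this

theorem Occurs.unique (h : κ.Occurs x v i c) (h' : κ.Occurs x v i d) : c = d :=
  κ.code_injective fun k h₀ h₁ => (h k h₀ h₁).symm.trans (h' k h₀ h₁)

theorem Occurs.hasCell (h : κ.Occurs x v i c) : κ.HasCell x v i := ⟨c, h⟩

theorem HasCell.eq_of_overlap (h : κ.HasCell x v i) (h' : κ.HasCell x u j)
    (hij : i < j + κ.len u) (hji : j < i + κ.len v) : i = j ∧ v = u := by
  obtain ⟨c, hc⟩ := h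
  obtain ⟨d, hd⟩ := h'
  rcases le_total i j with hle | hle
  · have := κ.eq_of_overlap (v := v) (u := u) (c := c) (d := d) (s := j - i) (by omega) (by omega)
      fun k h₁ h₂ h₃ => by
        rw [← hc k (by omega) h₂, hd.apply (j := i + k) (by omega) (by omega)]
        congr 1
        omega
    exact ⟨by omega, this.2⟩
  · have := κ.eq_of_overlap (v := u) (u := v) (c := d) (d := c) (s := i - j) (by omega) (by omega)
      fun k h₁ h₂ h₃ => by
        rw [← hd k (by omega) h₂, hc.apply (j := j + k) (by omega) (by omega)]
        congr 1
        omega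
    exact ⟨by omega, this.2.symm⟩

theorem HasCell.apply_zero (h : κ.HasCell x v i) : x i = κ.on := by
  obtain ⟨c, hc⟩ := h
  have := κ.two_le_len v
  simpa [κ.code_zero] using hc 0 le_rfl (by omega)

theorem HasCell.apply_one (h : κ.HasCell x v i) : x (i + 1) = κ.on := by
  obtain ⟨c, hc⟩ := h
  have := κ.two_le_len v
  simpa [κ.code_one] using hc 1 (by omega) (by omega)

theorem Occurs.apply_last (h : κ.Occurs x v i c) : x (i + κ.len v - 1) = κ.off := by
  have := κ.two_le_len v
  rw [h.apply (by omega) (by omega), ← κ.code_last v c]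
  congr 1
  omega

theorem Occurs.signal_iff (h : κ.Occurs x v i c) :
    x (i + κ.len v - 2) = κ.on ↔ c.1 true = c.2 := by
  have := κ.two_le_len v
  rw [h.apply (by omega) (by omega), ← κ.code_signal v c,
    show i + κ.len v - 2 - i = κ.len v - 2 by omega]

theorem occurs_congr (h : ∀ j, i ≤ j → j < i + κ.len v → x j = z j) :
    κ.Occurs x v i c ↔ κ.Occurs z v i c :=
  forall_congr' fun k => forall_congr' fun h₀ => forall_congr' fun h₁ => by
    rw [h (i + k) (by omega) (by omega)]

theorem hasCell_congr (h : ∀ j, i ≤ j → j < i + κ.len v → x j = z j) :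
    κ.HasCell x v i ↔ κ.HasCell z v i :=
  exists_congr fun _ => occurs_congr h

open Classical in
variable (κ) in
/-- Replace the cells of type `v` at the positions in `P` by the cells given by `F`. -/
noncomputable def overwrite (v : V) (P : ℤ → Prop) (F : ℤ → BeltCell (A v)) (x : ℤ → B) : ℤ → B :=
  fun j => if h : ∃ i, P i ∧ i ≤ j ∧ j < i + κ.len v then
    κ.code v (F h.choose) (j - h.choose) else x j

variable {P : ℤ → Prop} {F : ℤ → BeltCell (A v)}

theorem overwrite_apply_of_not (h : ∀ i, P i → i ≤ j → j < i + κ.len v → False) :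
    κ.overwrite v P F x j = x j :=
  dif_neg fun ⟨i, h₀, h₁, h₂⟩ => h i h₀ h₁ h₂

theorem occurs_overwrite (hP : ∀ i, P i → κ.HasCell x v i) (hi : P i) :
    κ.Occurs (κ.overwrite v P F x) v i (F i) := by
  intro k h₀ h₁
  have h : ∃ i', P i' ∧ i' ≤ i + k ∧ i + k < i' + κ.len v := ⟨i, hi, by omega, by omega⟩
  have hc : h.choose = i := by
    obtain ⟨a, b, c⟩ := h.choose_spec
    exact ((hP _ a).eq_of_overlap (hP _ hi) (by omega) (by omega)).1
  rw [overwrite, dif_pos h, hc, add_sub_cancel_left]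

/-- Any cell that meets a rewritten one, before or after the rewriting, coincides with it in
position and type, and the remaining cells see no change. Thus the pattern of types and positions is
an invariant of the whole action. -/
theorem hasCell_overwrite_iff (hP : ∀ i, P i → κ.HasCell x v i) :
    κ.HasCell (κ.overwrite v P F x) u i ↔ κ.HasCell x u i := by
  by_cases h : ∃ j, P j ∧ i < j + κ.len v ∧ j < i + κ.len u
  · obtain ⟨j, hj, h₁, h₂⟩ := h
    constructor
    · intro h
      obtain ⟨rfl, rfl⟩ := h.eq_of_overlap (occurs_overwrite hP hj).hasCell h₁ h₂
      exact hP _ hj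
    · intro h
      obtain ⟨rfl, rfl⟩ := h.eq_of_overlap (hP _ hj) h₁ h₂
      exact (occurs_overwrite hP hj).hasCell
  · exact hasCell_congr fun k h₁ h₂ => overwrite_apply_of_not fun i' h₀ h₃ h₄ =>
      h ⟨i', h₀, by omega, by omega⟩

theorem occurs_overwrite_iff {c : BeltCell (A u)} (hP : ∀ i, P i → κ.HasCell x v i)
    (hi : v = u → ¬ P i) : κ.Occurs (κ.overwrite v P F x) u i c ↔ κ.Occurs x u i c := by
  by_cases h : κ.HasCell x u i
  · refine occurs_congr fun k h₁ h₂ => overwrite_apply_of_not fun i' h₀ h₃ h₄ => ?_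
    obtain ⟨rfl, rfl⟩ := (hP i' h₀).eq_of_overlap h (by omega) (by omega)
    exact hi rfl h₀
  · have h' := (hasCell_overwrite_iff (u := u) (F := F) hP).not.mpr h
    exact ⟨fun hc => (h' hc.hasCell).elim, fun hc => (h hc.hasCell).elim⟩

theorem overwrite_comm {Q : ℤ → Prop} {H : ℤ → BeltCell (A u)} (huv : v ≠ u)
    (hP : ∀ i, P i → κ.HasCell x v i) (hQ : ∀ i, Q i → κ.HasCell x u i) :
    κ.overwrite v P F (κ.overwrite u Q H x) = κ.overwrite u Q H (κ.overwrite v P F x) := by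
  have hP' : ∀ i, P i → κ.HasCell (κ.overwrite u Q H x) v i := fun i hi =>
    (hasCell_overwrite_iff hQ).mpr (hP i hi)
  have hQ' : ∀ i, Q i → κ.HasCell (κ.overwrite v P F x) u i := fun i hi =>
    (hasCell_overwrite_iff hP).mpr (hQ i hi)
  funext j
  by_cases h : ∃ i, P i ∧ i ≤ j ∧ j < i + κ.len v
  · obtain ⟨i, hi, h₁, h₂⟩ := h
    rw [(occurs_overwrite hP' hi).apply h₁ h₂, overwrite_apply_of_not,
      (occurs_overwrite hP hi).apply h₁ h₂]
    intro k hk h₃ h₄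
    exact huv ((hP _ hi).eq_of_overlap (hQ _ hk) (by omega) (by omega)).2
  · rw [overwrite_apply_of_not fun i a b c => h ⟨i, a, b, c⟩]
    by_cases h' : ∃ i, Q i ∧ i ≤ j ∧ j < i + κ.len u
    · obtain ⟨i, hi, h₁, h₂⟩ := h'
      rw [(occurs_overwrite hQ' hi).apply h₁ h₂, (occurs_overwrite hQ hi).apply h₁ h₂]
    · rw [overwrite_apply_of_not fun i a b c => h' ⟨i, a, b, c⟩,
        overwrite_apply_of_not fun i a b c => h' ⟨i, a, b, c⟩,
        overwrite_apply_of_not fun i a b c => h ⟨i, a, b, c⟩]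

theorem overwrite_overwrite {H : ℤ → BeltCell (A v)} (hP : ∀ i, P i → κ.HasCell x v i) :
    κ.overwrite v P H (κ.overwrite v P F x) = κ.overwrite v P H x := by
  have hP' : ∀ i, P i → κ.HasCell (κ.overwrite v P F x) v i := fun i hi =>
    (hasCell_overwrite_iff hP).mpr (hP i hi)
  funext j
  by_cases h : ∃ i, P i ∧ i ≤ j ∧ j < i + κ.len v
  · obtain ⟨i, hi, h₁, h₂⟩ := h
    rw [(occurs_overwrite hP' hi).apply h₁ h₂, (occurs_overwrite hP hi).apply h₁ h₂]
  · iterate 3 rw [overwrite_apply_of_not fun i a b c => h ⟨i, a, b, c⟩]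

theorem overwrite_eq_self (h : ∀ i, P i → κ.Occurs x v i (F i)) : κ.overwrite v P F x = x := by
  funext j
  by_cases hj : ∃ i, P i ∧ i ≤ j ∧ j < i + κ.len v
  · obtain ⟨i, hi, h₁, h₂⟩ := hj
    rw [(occurs_overwrite (fun i hi => (h i hi).hasCell) hi).apply h₁ h₂, (h i hi).apply h₁ h₂]
  · rw [overwrite_apply_of_not fun i a b c => hj ⟨i, a, b, c⟩]

theorem overwrite_congr {H : ℤ → BeltCell (A v)} (hP : ∀ i, P i → κ.HasCell x v i)
    (h : ∀ i, P i → F i = H i) : κ.overwrite v P F x = κ.overwrite v P H x := by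
  funext j
  by_cases hj : ∃ i, P i ∧ i ≤ j ∧ j < i + κ.len v
  · obtain ⟨i, hi, h₁, h₂⟩ := hj
    rw [(occurs_overwrite hP hi).apply h₁ h₂, (occurs_overwrite hP hi).apply h₁ h₂, h i hi]
  · iterate 2 rw [overwrite_apply_of_not fun i a b c => hj ⟨i, a, b, c⟩]

section content

variable [∀ v, Nonempty (A v)]

variable (κ) in
/-- The cell of type `v` that occurs in `x` at position `i`. -/
noncomputable def content (x : ℤ → B) (v : V) (i : ℤ) : BeltCell (A v) :=
  Classical.epsilon fun c => κ.Occurs x v i c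

theorem HasCell.occurs_content (h : κ.HasCell x v i) : κ.Occurs x v i (κ.content x v i) :=
  Classical.epsilon_spec h

theorem Occurs.content_eq (h : κ.Occurs x v i c) : κ.content x v i = c :=
  h.hasCell.occurs_content.unique h

theorem content_congr (h : ∀ c, κ.Occurs x v i c ↔ κ.Occurs z v j c) :
    κ.content x v i = κ.content z v j :=
  congrArg Classical.epsilon (funext fun c => propext (h c))

theorem content_overwrite (hP : ∀ i, P i → κ.HasCell x v i) (hi : v = u → ¬ P i) :
    κ.content (κ.overwrite v P F x) u i = κ.content x u i :=
  content_congr fun _ => occurs_overwrite_iff hP hi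

end content

end CellCode

/-! ### Motion along conveyor belts. -/

section Belt

open Classical in
/-- Cross from the right end of `(i, true)` to the left end of `(i + L, false)` and back, if both
`i` and `i + L` satisfy `P`. -/
noncomputable def beltStep (P : ℤ → Prop) (L : ℤ) : ℤ × Bool → ℤ × Bool
  | (i, true) => if P i ∧ P (i + L) then (i + L, false) else (i, true)
  | (i, false) => if P i ∧ P (i - L) then (i - L, true) else (i, false)

/-- The motion is this involution followed by the exchange of the tracks. As a product of two
involutions it is a permutation, and at the end of a belt, where the crossing is impossible, the
exchange alone makes the turn. -/
theorem beltStep_involutive (P : ℤ → Prop) (L : ℤ) : Function.Involutive (beltStep P L) := by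
  rintro ⟨i, _ | _⟩
  · by_cases h : P i ∧ P (i - L)
    · have h' : P (i - L) ∧ P (i - L + L) := ⟨h.2, by rw [sub_add_cancel]; exact h.1⟩
      simp [beltStep, h]
    · simp [beltStep, h]
  · by_cases h : P i ∧ P (i + L)
    · simp [beltStep, h]
    · simp [beltStep, h]

/-- The motion along the conveyor belts formed by the positions in `P`, where consecutive positions
of a belt differ by `L`: to the right on the top track and to the left on the bottom track. -/
noncomputable def beltPerm (P : ℤ → Prop) (L : ℤ) : Equiv.Perm (ℤ × Bool) :=
  (beltStep_involutive P L).toPerm.trans ((Equiv.refl ℤ).prodCongr Equiv.boolNot)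

variable {P Q : ℤ → Prop} {L i : ℤ} {n : ℤ × Bool}

theorem beltPerm_true (h : P i) (h' : P (i + L)) : beltPerm P L (i, true) = (i + L, true) := by
  simp [beltPerm, beltStep, h, h']

theorem beltPerm_true_of_not (h' : ¬ P (i + L)) : beltPerm P L (i, true) = (i, false) := by
  simp [beltPerm, beltStep, h']

theorem beltPerm_false (h : P i) (h' : P (i - L)) : beltPerm P L (i, false) = (i - L, false) := by
  simp [beltPerm, beltStep, h, h']

theorem beltPerm_false_of_not (h' : ¬ P (i - L)) : beltPerm P L (i, false) = (i, true) := by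
  simp [beltPerm, beltStep, h']

theorem beltPerm_congr (h : P n.1 ↔ Q n.1) (h₁ : P (n.1 - L) ↔ Q (n.1 - L))
    (h₂ : P (n.1 + L) ↔ Q (n.1 + L)) : beltPerm P L n = beltPerm Q L n := by
  obtain ⟨i, _ | _⟩ := n
  · have e : (P i ∧ P (i - L)) = (Q i ∧ Q (i - L)) := propext (and_congr h h₁)
    simp only [beltPerm, Equiv.trans_apply, Function.Involutive.coe_toPerm, beltStep]
    split_ifs <;> simp_all
  · have e : (P i ∧ P (i + L)) = (Q i ∧ Q (i + L)) := propext (and_congr h h₂)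
    simp only [beltPerm, Equiv.trans_apply, Function.Involutive.coe_toPerm, beltStep]
    split_ifs <;> simp_all

theorem beltPerm_fst (hn : P n.1) :
    P (beltPerm P L n).1 ∧
      ((beltPerm P L n).1 = n.1 ∨ (beltPerm P L n).1 = n.1 + L ∨ (beltPerm P L n).1 = n.1 - L) := by
  obtain ⟨i, _ | _⟩ := n
  · by_cases h : P (i - L)
    · rw [beltPerm_false hn h]; simp [h]
    · rw [beltPerm_false_of_not h]; simpa using hn
  · by_cases h : P (i + L)
    · rw [beltPerm_true hn h]; simp [h]
    · rw [beltPerm_true_of_not h]; simpa using hn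

theorem beltPerm_inv_fst (hn : P n.1) :
    P ((beltPerm P L)⁻¹ n).1 ∧
      (((beltPerm P L)⁻¹ n).1 = n.1 ∨ ((beltPerm P L)⁻¹ n).1 = n.1 + L ∨
        ((beltPerm P L)⁻¹ n).1 = n.1 - L) := by
  obtain ⟨i, _ | _⟩ := n
  · by_cases h : P (i + L)
    · have : beltPerm P L (i + L, false) = (i, false) := by
        rw [beltPerm_false h (by simpa using hn), add_sub_cancel_right]
      rw [← this, Equiv.Perm.coe_inv, Equiv.symm_apply_apply]; simp [h, this]
    · rw [← beltPerm_true_of_not h, Equiv.Perm.coe_inv, Equiv.symm_apply_apply, beltPerm_true_of_not h]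
      simpa using hn
  · by_cases h : P (i - L)
    · have : beltPerm P L (i - L, true) = (i, true) := by
        rw [beltPerm_true h (by simpa using hn), sub_add_cancel]
      rw [← this, Equiv.Perm.coe_inv, Equiv.symm_apply_apply]; simp [h, this]
    · rw [← beltPerm_false_of_not h, Equiv.Perm.coe_inv, Equiv.symm_apply_apply, beltPerm_false_of_not h]
      simpa using hn

theorem beltPerm_zpow_fst (hn : P n.1) (k : ℤ) : P ((beltPerm P L ^ k) n).1 := by
  induction k with
  | zero => exact hn
  | succ k ih => rw [add_comm, zpow_add, zpow_one]; exact (beltPerm_fst ih).1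
  | pred k ih =>
    rw [sub_eq_add_neg, add_comm, zpow_add, zpow_neg_one]; exact (beltPerm_inv_fst ih).1

/-- The belts of `P` and of `Q` agree inside a set `S` of positions that is not connected to its
complement. -/
theorem beltPerm_zpow_eq_of_isolated {S : ℤ → Prop} (hPQ : ∀ i, S i → (P i ↔ Q i))
    (hP : ∀ i, S i → P i → (P (i + L) → S (i + L)) ∧ (P (i - L) → S (i - L)))
    (hQ : ∀ i, S i → Q i → (Q (i + L) → S (i + L)) ∧ (Q (i - L) → S (i - L)))
    (hS : S n.1) (hn : P n.1) (k : ℤ) :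
    S ((beltPerm P L ^ k) n).1 ∧ (beltPerm P L ^ k) n = (beltPerm Q L ^ k) n := by
  have key : ∀ n : ℤ × Bool, S n.1 → P n.1 → beltPerm P L n = beltPerm Q L n := by
    rintro ⟨i, _ | _⟩ hS hn
    · have hQn := (hPQ i hS).mp hn
      by_cases h : P (i - L)
      · rw [beltPerm_false hn h, beltPerm_false hQn ((hPQ _ ((hP i hS hn).2 h)).mp h)]
      · have h' : ¬ Q (i - L) := fun h' => h ((hPQ _ ((hQ i hS hQn).2 h')).mpr h')
        rw [beltPerm_false_of_not h, beltPerm_false_of_not h']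
    · have hQn := (hPQ i hS).mp hn
      by_cases h : P (i + L)
      · rw [beltPerm_true hn h, beltPerm_true hQn ((hPQ _ ((hP i hS hn).1 h)).mp h)]
      · have h' : ¬ Q (i + L) := fun h' => h ((hPQ _ ((hQ i hS hQn).1 h')).mpr h')
        rw [beltPerm_true_of_not h, beltPerm_true_of_not h']
  have clos : ∀ i j, S i → P i → P j → (j = i ∨ j = i + L ∨ j = i - L) → S j := by
    rintro i j hi hPi hPj (rfl | rfl | rfl)
    · exact hi
    · exact (hP i hi hPi).1 hPj
    · exact (hP i hi hPi).2 hPj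
  induction k with
  | zero => exact ⟨hS, rfl⟩
  | succ k ih =>
    have hp := beltPerm_zpow_fst (L := L) hn k
    rw [add_comm, zpow_add, zpow_one, zpow_add, zpow_one, Equiv.Perm.mul_apply,
      Equiv.Perm.mul_apply, ← ih.2]
    exact ⟨clos _ _ ih.1 hp (beltPerm_fst hp).1 (beltPerm_fst hp).2, key _ ih.1 hp⟩
  | pred k ih =>
    have hp := beltPerm_zpow_fst (L := L) hn (-k)
    rw [sub_eq_add_neg, add_comm, zpow_add, zpow_neg_one, zpow_add, zpow_neg_one,
      Equiv.Perm.mul_apply, Equiv.Perm.mul_apply, ← ih.2]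
    have h₁ := clos _ _ ih.1 hp (beltPerm_inv_fst hp).1 (beltPerm_inv_fst (L := L) hp).2
    refine ⟨h₁, ?_⟩
    rw [Equiv.Perm.eq_inv_iff_eq, ← key _ h₁ (beltPerm_inv_fst hp).1, Equiv.Perm.coe_inv, Equiv.apply_symm_apply]

/-- The motion for translated positions is conjugate to the original one by the translation. This
yields the shift equivariance of the action. -/
theorem beltPerm_add_right (s : ℤ) (n : ℤ × Bool) (k : ℤ) :
    (beltPerm P L ^ k) (n.1 + s, n.2) =
      (((beltPerm (fun i => P (i + s)) L ^ k) n).1 + s,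
        ((beltPerm (fun i => P (i + s)) L ^ k) n).2) := by
  have h : beltPerm P L = ((Equiv.addRight s).prodCongr (Equiv.refl Bool)).symm.trans
      ((beltPerm (fun i => P (i + s)) L).trans
        ((Equiv.addRight s).prodCongr (Equiv.refl Bool))) := by
    ext1 m
    obtain ⟨i, _ | _⟩ := m
    · by_cases h : P i ∧ P (i - L)
      · have e : i + -s - L + s = i - L := by ring
        simp [beltPerm, beltStep, h, e]
      · have e : i + -s - L + s = i - L := by ring
        simp [beltPerm, beltStep, h, e]
    · by_cases h : P i ∧ P (i + L)
      · have e : i + -s + L + s = i + L := by ring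
        simp [beltPerm, beltStep, h, e]
      · have e : i + -s + L + s = i + L := by ring
        simp [beltPerm, beltStep, h, e]
  have h' : beltPerm P L = ((Equiv.addRight s).prodCongr (Equiv.refl Bool)) *
      beltPerm (fun i => P (i + s)) L * ((Equiv.addRight s).prodCongr (Equiv.refl Bool))⁻¹ := h
  rw [h', conj_zpow]
  simp [Equiv.Perm.mul_apply, Prod.map]

end Belt

namespace FullShiftAut

variable {A : Type*} [TopologicalSpace A]

theorem apply_add (f : FullShiftAut A) (q : ℤ → A) (k j : ℤ) :
    f.1 (fun l => q (l + k)) j = f.1 q (j + k) := by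
  have h : ∀ (q : ℤ → A) (j : ℤ), f.1 (fun l => q (l + 1)) j = f.1 q (j + 1) := by
    intro q j
    have e : (fun l => q (l + 1)) = SymbolicDynamics.FullShift.shift 1 q := by
      funext l; rw [SymbolicDynamics.FullShift.shift_apply, add_comm]
    rw [e, f.2 q, SymbolicDynamics.FullShift.shift_apply, add_comm]
  induction k generalizing j with
  | zero => simp
  | succ k ih =>
    have := h (fun l => q (l + k)) j
    simp only [add_assoc, add_comm (1 : ℤ)] at this
    rw [this, ih]
    exact congrArg _ (by ring)
  | pred k ih =>
    have := h (fun l => q (l + (-k - 1))) (j - 1)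
    simp only [sub_add_cancel, add_assoc] at this
    rw [← this]
    have e : ∀ l : ℤ, l + (1 + (-(k : ℤ) - 1)) = l + -k := fun l => by ring
    simp only [e]
    rw [ih]
    exact congrArg _ (by ring)

end FullShiftAut

/-! ### The action on belts and the commutation of adjacent types. -/

namespace CellCode

variable {V : Type*} {A : V → Type*} {B : Type*} (κ : CellCode V A B) (Γ : SimpleGraph V)
variable {x y z : ℤ → B} {v u : V} {i j : ℤ}

/-- The cell of type `v` at position `i` is not next to a cell of smaller rank whose type is
adjacent to `v`. -/
def Alive (x : ℤ → B) (v : V) (i : ℤ) : Prop :=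
  κ.HasCell x v i ∧ ∀ u, Γ.Adj u v → κ.rank u < κ.rank v →
    ¬ κ.HasCell x u (i - κ.len u) ∧ ¬ κ.HasCell x u (i + κ.len v)

/-- The cell of type `v` at position `i` takes part in a belt: the first cell of a belt has to be
switched on by a signal to its left. -/
def Active (x : ℤ → B) (v : V) (i : ℤ) : Prop :=
  κ.Alive Γ x v i ∧ (κ.Alive Γ x v (i - κ.len v) ∨ x (i - 2) = κ.on)

/-- The motion along the belts of type `v`. -/
noncomputable def belt (x : ℤ → B) (v : V) : Equiv.Perm (ℤ × Bool) :=
  beltPerm (κ.Active Γ x v) (κ.len v)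

variable {κ Γ}

theorem Active.hasCell (h : κ.Active Γ x v i) : κ.HasCell x v i := h.1.1

theorem alive_congr (h : ∀ u i, κ.HasCell x u i ↔ κ.HasCell z u i) :
    κ.Alive Γ x v i ↔ κ.Alive Γ z v i := by
  simp only [Alive, h]

variable {P : ℤ → Prop} {F : ℤ → BeltCell (A v)}

/-- Overwriting active cells of type `v` does not change the signals to the first cells of belts of
type `u`, if `u` is `v` or adjacent to `v`. -/
theorem active_overwrite_iff (huv : u = v ∨ Γ.Adj u v) (hP : ∀ i, P i → κ.Active Γ x v i) :
    κ.Active Γ (κ.overwrite v P F x) u i ↔ κ.Active Γ x u i := by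
  have hP' : ∀ i, P i → κ.HasCell x v i := fun i hi => (hP i hi).hasCell
  have ha : ∀ i, κ.Alive Γ (κ.overwrite v P F x) u i ↔ κ.Alive Γ x u i := fun i =>
    alive_congr fun u i => hasCell_overwrite_iff hP'
  unfold Active
  rw [ha, ha]
  refine and_congr_right fun hu => ?_
  by_cases hl : κ.Alive Γ x u (i - κ.len u)
  · simp [hl]
  -- The letter at `i - 2` could change only inside a rewritten cell. If that cell ends at `i - 1`,
  -- this is its last letter, which is always `off`. If it ends at `i`, two live cells of equal or
  -- adjacent types touch: equal types contradict `hl`, and for adjacent types the cell of larger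
  -- rank would be dead.
  · suffices κ.overwrite v P F x (i - 2) = x (i - 2) by rw [this]
    have := κ.two_le_len v
    by_cases h : ∃ j, P j ∧ j ≤ i - 2 ∧ i - 2 < j + κ.len v
    · obtain ⟨j, hj, h₁, h₂⟩ := h
      have h₃ : j + κ.len v ≤ i := by
        by_contra h₃
        have := κ.two_le_len u
        obtain ⟨rfl, -⟩ := (hP' j hj).eq_of_overlap hu.1 (by omega) (by omega)
        omega
      rcases h₃.lt_or_eq with h₄ | h₄
      · obtain ⟨c, hc⟩ := hP' j hj
        have e : i - 2 = j + κ.len v - 1 := by omega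
        rw [e, (occurs_overwrite hP' hj).apply_last, hc.apply_last]
      · exfalso
        rcases huv with rfl | huv
        · exact hl (by rw [← h₄, add_sub_cancel_right]; exact (hP j hj).1)
        · rcases lt_trichotomy (κ.rank u) (κ.rank v) with h₅ | h₅ | h₅
          · exact (((hP j hj).1.2 u huv h₅).2) (by rw [h₄]; exact hu.1)
          · exact huv.ne (κ.rank_injective h₅)
          · refine (hu.2 v huv.symm h₅).1 ?_
            rw [← h₄, add_sub_cancel_right]
            exact hP' j hj
    · exact overwrite_apply_of_not fun j hj h₁ h₂ => h ⟨j, hj, h₁, h₂⟩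

theorem active_belt_zpow {n : ℤ × Bool} (h : κ.Active Γ x v n.1) (k : ℤ) :
    κ.Active Γ x v ((κ.belt Γ x v ^ k) n).1 :=
  beltPerm_zpow_fst h k

variable [∀ v, Nonempty (A v)]

variable (κ Γ) in
/-- The sequence of symbols on a belt of type `v`, seen from the node `n`. -/
noncomputable def reading (x : ℤ → B) (v : V) (n : ℤ × Bool) : ℤ → A v :=
  fun k => (κ.content x v ((κ.belt Γ x v ^ k) n).1).1 ((κ.belt Γ x v ^ k) n).2

variable (κ Γ) in
/-- The cell at position `i` after the application of `f` to the belts of type `v`. -/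
noncomputable def newCell (v : V) (f : (ℤ → A v) → ℤ → A v) (x : ℤ → B) (i : ℤ) :
    BeltCell (A v) :=
  (fun b => f (κ.reading Γ x v (i, b)) 0, (κ.content x v i).2)

variable (κ Γ) in
/-- The application of `f` to the belts of type `v`. -/
noncomputable def onBelts (v : V) (f : (ℤ → A v) → ℤ → A v) (x : ℤ → B) : ℤ → B :=
  κ.overwrite v (κ.Active Γ x v) (κ.newCell Γ v f x) x

section basic

variable {f : (ℤ → A v) → ℤ → A v}

theorem hasCell_onBelts : κ.HasCell (κ.onBelts Γ v f x) u i ↔ κ.HasCell x u i :=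
  hasCell_overwrite_iff fun _ h => h.hasCell

theorem active_onBelts (huv : u = v ∨ Γ.Adj u v) :
    κ.Active Γ (κ.onBelts Γ v f x) u i ↔ κ.Active Γ x u i :=
  active_overwrite_iff huv fun _ h => h

theorem belt_onBelts (huv : u = v ∨ Γ.Adj u v) :
    κ.belt Γ (κ.onBelts Γ v f x) u = κ.belt Γ x u := by
  unfold belt
  congr 1
  funext i
  exact propext (active_onBelts huv)

theorem occurs_onBelts (h : κ.Active Γ x v i) :
    κ.Occurs (κ.onBelts Γ v f x) v i (κ.newCell Γ v f x i) :=
  occurs_overwrite (fun _ h => h.hasCell) h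

theorem content_onBelts (h : κ.Active Γ x v i) :
    κ.content (κ.onBelts Γ v f x) v i = κ.newCell Γ v f x i :=
  (occurs_onBelts h).content_eq

theorem onBelts_apply_of_not (h : ∀ i, κ.Active Γ x v i → i ≤ j → j < i + κ.len v → False) :
    κ.onBelts Γ v f x j = x j :=
  overwrite_apply_of_not h

theorem content_onBelts_of_ne (h : v ≠ u) :
    κ.content (κ.onBelts Γ v f x) u i = κ.content x u i :=
  content_overwrite (fun _ h => h.hasCell) fun e => (h e).elim

theorem newCell_onBelts_of_adj (h : Γ.Adj u v) {g : (ℤ → A u) → ℤ → A u} :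
    κ.newCell Γ u g (κ.onBelts Γ v f x) = κ.newCell Γ u g x := by
  funext i
  unfold newCell reading
  simp only [belt_onBelts (Or.inr h), content_onBelts_of_ne h.ne']

theorem onBelts_eq_overwrite (h : ∀ i, κ.Active Γ y v i ↔ κ.Active Γ x v i) :
    κ.onBelts Γ v f y = κ.overwrite v (κ.Active Γ x v) (κ.newCell Γ v f y) y := by
  have e : κ.Active Γ y v = κ.Active Γ x v := funext fun i => propext (h i)
  rw [onBelts, e]

/-- Neither action changes the belts or the contents of the other type, so each writes the same
cells in either order, and cells of different types are disjoint. -/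
theorem onBelts_comm (h : Γ.Adj u v) {g : (ℤ → A u) → ℤ → A u} :
    κ.onBelts Γ u g (κ.onBelts Γ v f x) = κ.onBelts Γ v f (κ.onBelts Γ u g x) := by
  rw [onBelts_eq_overwrite fun _ => active_onBelts (Or.inr h), newCell_onBelts_of_adj h,
    onBelts_eq_overwrite fun _ => active_onBelts (Or.inr h.symm), newCell_onBelts_of_adj h.symm]
  exact overwrite_comm h.ne (fun _ h => h.hasCell) fun _ h => h.hasCell

theorem onBelts_id : κ.onBelts Γ v id x = x :=
  overwrite_eq_self fun i hi => by
    have h := hi.hasCell.occurs_content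
    have e : κ.newCell Γ v id x i = κ.content x v i := by
      ext b <;> simp [newCell, reading]
    rwa [e]

end basic

variable [∀ v, TopologicalSpace (A v)]

/-- The belts are unchanged, and the sequence read from the node `k` steps further on is the shift
by `k` of the sequence read from `n`. Since `f` commutes with the shift, the symbols written at the
separate nodes fit together to one image under `f`. -/
theorem reading_onBelts (f : FullShiftAut (A v)) {n : ℤ × Bool} (hn : κ.Active Γ x v n.1) :
    κ.reading Γ (κ.onBelts Γ v f.1 x) v n = f.1 (κ.reading Γ x v n) := by
  funext k
  have h := active_belt_zpow hn k
  conv_lhs => unfold reading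
  rw [belt_onBelts (Or.inl rfl), content_onBelts h]
  change f.1 _ 0 = _
  rw [← zero_add k, ← FullShiftAut.apply_add, zero_add]
  refine congrFun (congrArg _ (funext fun l => ?_)) 0
  unfold reading
  rw [Prod.mk.eta, zpow_add, Equiv.Perm.mul_apply]

theorem onBelts_mul (f g : FullShiftAut (A v)) :
    κ.onBelts Γ v (f * g).1 x = κ.onBelts Γ v f.1 (κ.onBelts Γ v g.1 x) := by
  rw [onBelts_eq_overwrite (y := κ.onBelts Γ v g.1 x) fun _ => active_onBelts (Or.inl rfl),
    onBelts, onBelts, overwrite_overwrite fun _ h => h.hasCell, ← onBelts]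
  refine overwrite_congr (fun _ h => h.hasCell) fun i hi => ?_
  change _ = κ.newCell Γ v f.1 (κ.onBelts Γ v g.1 x) i
  refine Prod.ext (funext fun b => ?_) ?_
  · change (f * g).1 _ 0 = f.1 (κ.reading Γ (κ.onBelts Γ v g.1 x) v (i, b)) 0
    rw [reading_onBelts g hi]
    rfl
  · change _ = (κ.content (κ.onBelts Γ v g.1 x) v i).2
    rw [content_onBelts hi]
    rfl

end CellCode

/-! ### Shift equivariance and continuity of the action. -/

namespace CellCode

variable {V : Type*} {A : V → Type*} {B : Type*} (κ : CellCode V A B) (Γ : SimpleGraph V)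
variable {x y z : ℤ → B} {v u : V} {i j : ℤ} {κ Γ}

section shift

theorem occurs_shift {c : BeltCell (A v)} (s : ℤ) :
    κ.Occurs (fun l => x (l + s)) v i c ↔ κ.Occurs x v (i + s) c := by
  simp only [Occurs, add_right_comm]

theorem hasCell_shift (s : ℤ) : κ.HasCell (fun l => x (l + s)) v i ↔ κ.HasCell x v (i + s) :=
  exists_congr fun _ => occurs_shift s

theorem alive_shift (s : ℤ) : κ.Alive Γ (fun l => x (l + s)) v i ↔ κ.Alive Γ x v (i + s) := by
  simp only [Alive, hasCell_shift, sub_add_eq_add_sub, add_right_comm]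

theorem active_shift (s : ℤ) : κ.Active Γ (fun l => x (l + s)) v i ↔ κ.Active Γ x v (i + s) := by
  simp only [Active, alive_shift, sub_add_eq_add_sub]

variable [∀ v, Nonempty (A v)]

theorem content_shift (s : ℤ) : κ.content (fun l => x (l + s)) v i = κ.content x v (i + s) :=
  content_congr fun _ => occurs_shift s

theorem reading_shift (s : ℤ) (n : ℤ × Bool) :
    κ.reading Γ (fun l => x (l + s)) v n = κ.reading Γ x v (n.1 + s, n.2) := by
  funext k
  have e : κ.Active Γ (fun l => x (l + s)) v = fun i => κ.Active Γ x v (i + s) :=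
    funext fun i => propext (active_shift s)
  simp only [reading, belt, e, content_shift, beltPerm_add_right s n k]

theorem onBelts_shift (f : (ℤ → A v) → ℤ → A v) (s : ℤ) :
    κ.onBelts Γ v f (fun l => x (l + s)) = fun l => κ.onBelts Γ v f x (l + s) := by
  have hn : ∀ i, κ.newCell Γ v f (fun l => x (l + s)) i = κ.newCell Γ v f x (i + s) := fun i => by
    simp only [newCell, reading_shift, content_shift]
  funext j
  by_cases h : ∃ i, κ.Active Γ x v (i + s) ∧ i ≤ j ∧ j < i + κ.len v
  · obtain ⟨i, hi, h₁, h₂⟩ := h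
    rw [(occurs_onBelts ((active_shift s).mpr hi)).apply h₁ h₂,
      (occurs_onBelts hi).apply (by omega) (by omega), hn, add_sub_add_right_eq_sub]
  · rw [onBelts_apply_of_not fun i hi h₁ h₂ => h ⟨i, (active_shift s).mp hi, h₁, h₂⟩,
      onBelts_apply_of_not]
    exact fun i hi h₁ h₂ => h ⟨i - s, by rwa [sub_add_cancel], by omega, by omega⟩

end shift

section continuity

open Filter Topology

variable [TopologicalSpace B] [DiscreteTopology B]

theorem eventually_apply_eq (x : ℤ → B) (j : ℤ) : ∀ᶠ y in 𝓝 x, y j = x j :=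
  (continuous_apply j).continuousAt.eventually_mem ((isOpen_discrete {x j}).mem_nhds rfl)

theorem eventually_occurs_iff (x : ℤ → B) (v : V) (i : ℤ) :
    ∀ᶠ y in 𝓝 x, ∀ c, κ.Occurs y v i c ↔ κ.Occurs x v i c := by
  have : ∀ᶠ y in 𝓝 x, ∀ j ∈ Set.Ico i (i + κ.len v), y j = x j := by
    rw [Filter.eventually_all_finite (Set.finite_Ico _ _)]
    exact fun j _ => eventually_apply_eq x j
  filter_upwards [this] with y hy c using occurs_congr fun j h₁ h₂ => hy j ⟨h₁, h₂⟩

theorem eventually_hasCell_iff (x : ℤ → B) (v : V) (i : ℤ) :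
    ∀ᶠ y in 𝓝 x, (κ.HasCell y v i ↔ κ.HasCell x v i) := by
  filter_upwards [eventually_occurs_iff (κ := κ) x v i] with y hy using exists_congr hy

/-- Only types of rank smaller than that of `v` matter, and there are finitely many of them. This is
what the ranks provide when `V` is infinite. -/
theorem eventually_alive_iff (x : ℤ → B) (v : V) (i : ℤ) :
    ∀ᶠ y in 𝓝 x, (κ.Alive Γ y v i ↔ κ.Alive Γ x v i) := by
  have hfin : {u | κ.rank u < κ.rank v}.Finite :=
    (Set.finite_Iio (κ.rank v)).preimage κ.rank_injective.injOn
  have h₁ : ∀ᶠ y in 𝓝 x, ∀ u ∈ {u | κ.rank u < κ.rank v},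
      (κ.HasCell y u (i - κ.len u) ↔ κ.HasCell x u (i - κ.len u)) ∧
        (κ.HasCell y u (i + κ.len v) ↔ κ.HasCell x u (i + κ.len v)) := by
    rw [Filter.eventually_all_finite hfin]
    exact fun u _ => (eventually_hasCell_iff x u _).and (eventually_hasCell_iff x u _)
  filter_upwards [h₁, eventually_hasCell_iff (κ := κ) x v i] with y h₁ h₂
  refine and_congr h₂ (forall_congr' fun u => forall_congr' fun _ => forall_congr' fun hu => ?_)
  rw [(h₁ u hu).1, (h₁ u hu).2]

theorem eventually_active_iff (x : ℤ → B) (v : V) (i : ℤ) :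
    ∀ᶠ y in 𝓝 x, (κ.Active Γ y v i ↔ κ.Active Γ x v i) := by
  filter_upwards [eventually_alive_iff (κ := κ) (Γ := Γ) x v i,
    eventually_alive_iff (κ := κ) (Γ := Γ) x v (i - κ.len v), eventually_apply_eq x (i - 2)]
    with y h₁ h₂ h₃
  rw [Active, h₁, h₂, h₃, Active]

theorem eventually_belt_eq (x : ℤ → B) (v : V) (n : ℤ × Bool) :
    ∀ᶠ y in 𝓝 x, κ.belt Γ y v n = κ.belt Γ x v n := by
  filter_upwards [eventually_active_iff (κ := κ) (Γ := Γ) x v n.1,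
    eventually_active_iff (κ := κ) (Γ := Γ) x v (n.1 - κ.len v),
    eventually_active_iff (κ := κ) (Γ := Γ) x v (n.1 + κ.len v)] with y h₁ h₂ h₃
  exact beltPerm_congr h₁ h₂ h₃

theorem eventually_belt_inv_eq (x : ℤ → B) (v : V) (n : ℤ × Bool) :
    ∀ᶠ y in 𝓝 x, (κ.belt Γ y v)⁻¹ n = (κ.belt Γ x v)⁻¹ n := by
  filter_upwards [eventually_belt_eq (κ := κ) (Γ := Γ) x v ((κ.belt Γ x v)⁻¹ n)] with y hy
  rw [Equiv.Perm.inv_eq_iff_eq, hy, Equiv.Perm.coe_inv, Equiv.apply_symm_apply]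

theorem eventually_belt_zpow_eq (x : ℤ → B) (v : V) (n : ℤ × Bool) (k : ℤ) :
    ∀ᶠ y in 𝓝 x, (κ.belt Γ y v ^ k) n = (κ.belt Γ x v ^ k) n := by
  induction k with
  | zero => exact Eventually.of_forall fun _ => rfl
  | succ k ih =>
    filter_upwards [ih, eventually_belt_eq (κ := κ) (Γ := Γ) x v ((κ.belt Γ x v ^ (k : ℤ)) n)]
      with y h₁ h₂
    rw [add_comm, zpow_add, zpow_one, Equiv.Perm.mul_apply, h₁, h₂, zpow_add, zpow_one,
      Equiv.Perm.mul_apply]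
  | pred k ih =>
    filter_upwards [ih,
      eventually_belt_inv_eq (κ := κ) (Γ := Γ) x v ((κ.belt Γ x v ^ (-k : ℤ)) n)] with y h₁ h₂
    rw [sub_eq_add_neg, add_comm, zpow_add, zpow_neg_one, Equiv.Perm.mul_apply, h₁, h₂, zpow_add,
      zpow_neg_one, Equiv.Perm.mul_apply]

variable [∀ v, Nonempty (A v)]

theorem eventually_content_eq (x : ℤ → B) (v : V) (i : ℤ) :
    ∀ᶠ y in 𝓝 x, κ.content y v i = κ.content x v i := by
  filter_upwards [eventually_occurs_iff (κ := κ) x v i] with y hy using content_congr hy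

variable [∀ v, TopologicalSpace (A v)]

/-- A belt may be infinite, but its `k`-th entry is reached in `|k|` steps, each of which depends on
a finite window. -/
theorem continuous_reading (v : V) (n : ℤ × Bool) :
    Continuous fun x : ℤ → B => κ.reading Γ x v n := by
  refine continuous_pi fun k => continuous_iff_continuousAt.mpr fun x => ?_
  refine tendsto_const_nhds.congr' ?_
  filter_upwards [eventually_belt_zpow_eq (κ := κ) (Γ := Γ) x v n k,
    eventually_content_eq (κ := κ) x v ((κ.belt Γ x v ^ k) n).1] with y h₁ h₂
  simp only [reading, h₁, h₂]

variable [∀ v, DiscreteTopology (A v)] {f : (ℤ → A v) → ℤ → A v}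

theorem eventually_newCell_eq (hf : Continuous f) (x : ℤ → B) (i : ℤ) :
    ∀ᶠ y in 𝓝 x, κ.newCell Γ v f y i = κ.newCell Γ v f x i := by
  have h : ∀ b, ∀ᶠ y in 𝓝 x, f (κ.reading Γ y v (i, b)) 0 = f (κ.reading Γ x v (i, b)) 0 :=
    fun b => ((continuous_apply 0).comp (hf.comp
      (continuous_reading v (i, b)))).continuousAt.eventually_mem
        ((isOpen_discrete {f (κ.reading Γ x v (i, b)) 0}).mem_nhds rfl)
  filter_upwards [h true, h false, eventually_content_eq (κ := κ) x v i] with y h₁ h₂ h₃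
  refine Prod.ext (funext fun b => ?_) (by simp only [newCell, h₃])
  cases b
  · exact h₂
  · exact h₁

theorem continuous_onBelts (hf : Continuous f) :
    Continuous (κ.onBelts Γ v f : (ℤ → B) → ℤ → B) := by
  refine continuous_pi fun j => continuous_iff_continuousAt.mpr fun x => ?_
  refine tendsto_const_nhds.congr' ?_
  by_cases h : ∃ i, κ.Active Γ x v i ∧ i ≤ j ∧ j < i + κ.len v
  · obtain ⟨i, hi, h₁, h₂⟩ := h
    filter_upwards [eventually_active_iff (κ := κ) (Γ := Γ) x v i, eventually_newCell_eq hf x i]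
      with y h₃ h₄
    rw [(occurs_onBelts hi).apply h₁ h₂, (occurs_onBelts (h₃.mpr hi)).apply h₁ h₂, h₄]
  · have : ∀ᶠ y in 𝓝 x, ∀ i ∈ Set.Ioc (j - κ.len v) j,
        (κ.Active Γ y v i ↔ κ.Active Γ x v i) := by
      rw [Filter.eventually_all_finite (Set.finite_Ioc _ _)]
      exact fun i _ => eventually_active_iff x v i
    filter_upwards [this, eventually_apply_eq x j] with y h₃ h₄
    rw [onBelts_apply_of_not fun i a b c => h ⟨i, a, b, c⟩, onBelts_apply_of_not, h₄]
    exact fun i a b c => h ⟨i, (h₃ i ⟨by omega, b⟩).mp a, b, c⟩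

end continuity

section hom

variable [TopologicalSpace B] [DiscreteTopology B] [∀ v, Nonempty (A v)]
  [∀ v, TopologicalSpace (A v)] [∀ v, DiscreteTopology (A v)]

variable (κ Γ) in
/-- The action of `Aut(A_v^ℤ)` on `B^ℤ` through the belts of type `v`. -/
noncomputable def beltHom (v : V) : FullShiftAut (A v) →* FullShiftAut B where
  toFun f :=
    ⟨{  toFun := κ.onBelts Γ v f.1
        invFun := κ.onBelts Γ v (f⁻¹).1
        left_inv := fun x => by rw [← onBelts_mul, inv_mul_cancel]; exact onBelts_id
        right_inv := fun x => by rw [← onBelts_mul, mul_inv_cancel]; exact onBelts_id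
        continuous_toFun := continuous_onBelts f.1.continuous
        continuous_invFun := continuous_onBelts (f⁻¹).1.continuous },
      fun x => by
        have e : ∀ y : ℤ → B, SymbolicDynamics.FullShift.shift 1 y = fun l => y (l + 1) := fun y =>
          funext fun l => by rw [SymbolicDynamics.FullShift.shift_apply, add_comm]
        rw [e, e]
        exact onBelts_shift f.1 1⟩
  map_one' := Subtype.ext (Homeomorph.ext fun _ => onBelts_id)
  map_mul' f g := Subtype.ext (Homeomorph.ext fun _ => onBelts_mul f g)

theorem commute_beltHom (h : Γ.Adj u v) (f : FullShiftAut (A u)) (g : FullShiftAut (A v)) :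
    Commute (κ.beltHom Γ u f) (κ.beltHom Γ v g) :=
  Subtype.ext (Homeomorph.ext fun _ => onBelts_comm h)

end hom

end CellCode

/-! ### Finite cyclic belts. -/

section BeltNode

/-- The `k`-th node, counted from the last node of the top track, of the cyclic belt through the
positions `a, a + L, …, a + (m - 1) * L`. -/
def beltNode (a L m k : ℤ) : ℤ × Bool :=
  if (k - 1) % (2 * m) < m then (a + (m - 1 - (k - 1) % (2 * m)) * L, false)
  else (a + ((k - 1) % (2 * m) - m) * L, true)

variable {P : ℤ → Prop} {a L m : ℤ}

theorem beltNode_add_period (k : ℤ) : beltNode a L m (k + 2 * m) = beltNode a L m k := by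
  simp only [beltNode, add_sub_right_comm, Int.add_emod_right]

theorem beltNode_zero (hm : 1 ≤ m) : beltNode a L m 0 = (a + (m - 1) * L, true) := by
  have : (0 - 1 : ℤ) % (2 * m) = 2 * m - 1 := by
    rw [← Int.add_emod_right, Int.emod_eq_of_lt] <;> omega
  rw [beltNode, this, if_neg (by omega)]
  congr 3
  omega

theorem beltPerm_beltNode (hm : 1 ≤ m) (hP : ∀ j, 0 ≤ j → j < m → P (a + j * L))
    (hl : ¬ P (a - L)) (hr : ¬ P (a + m * L)) (k : ℤ) :
    beltPerm P L (beltNode a L m k) = beltNode a L m (k + 1) := by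
  have h₀ := Int.emod_nonneg (k - 1) (show 2 * m ≠ 0 by omega)
  have h₁ := Int.emod_lt_of_pos (k - 1) (show 0 < 2 * m by omega)
  have h₂ : (k + 1 - 1) % (2 * m) = ((k - 1) % (2 * m) + 1) % (2 * m) := by
    rw [Int.emod_add_emod]; congr 1; ring
  unfold beltNode
  rw [h₂]
  generalize (k - 1) % (2 * m) = r at *
  -- The residue `r` runs down the bottom track for `r < m` and up the top track afterwards. The two
  -- turns occur at `r = 2m - 1` (right end) and `r = m - 1` (left end).
  by_cases hr₁ : r + 1 = 2 * m
  · have e : a + (r - m) * L + L = a + m * L := by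
      rw [show r - m = m - 1 by omega]; ring
    rw [if_neg (by omega), hr₁, Int.emod_self, if_pos (by omega),
      beltPerm_true_of_not (by rwa [e]), show r - m = m - 1 - 0 by omega]
  · rw [Int.emod_eq_of_lt (by omega) (by omega)]
    by_cases hr₂ : r < m
    · rw [if_pos hr₂]
      by_cases hr₃ : r + 1 < m
      · have e : a + (m - 1 - r) * L - L = a + (m - 1 - (r + 1)) * L := by ring
        rw [if_pos hr₃, beltPerm_false (hP _ (by omega) (by omega)) (by
          rw [e]; exact hP _ (by omega) (by omega)), e]
      · have e : m - 1 - r = 0 := by omega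
        rw [if_neg hr₃, e, zero_mul, add_zero, beltPerm_false_of_not hl,
          show r + 1 - m = 0 by omega, zero_mul, add_zero]
    · have e : a + (r - m) * L + L = a + (r + 1 - m) * L := by ring
      rw [if_neg hr₂, if_neg (by omega), beltPerm_true (hP _ (by omega) (by omega)) (by
        rw [e]; exact hP _ (by omega) (by omega)), e]

theorem beltPerm_zpow_beltNode (hm : 1 ≤ m) (hP : ∀ j, 0 ≤ j → j < m → P (a + j * L))
    (hl : ¬ P (a - L)) (hr : ¬ P (a + m * L)) (k : ℤ) :
    (beltPerm P L ^ k) (a + (m - 1) * L, true) = beltNode a L m k := by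
  have h := beltPerm_beltNode hm hP hl hr
  rw [← beltNode_zero hm]
  induction k with
  | zero => rfl
  | succ k ih => rw [add_comm, zpow_add, zpow_one, Equiv.Perm.mul_apply, ih, h, add_comm]
  | pred k ih =>
    rw [sub_eq_add_neg, add_comm, zpow_add, zpow_neg_one, Equiv.Perm.mul_apply, ih,
      Equiv.Perm.inv_eq_iff_eq, h]
    congr 1
    ring

end BeltNode

/-! ### Separating positions, across which only a signal passes to the right. -/

namespace CellCode

variable {V : Type*} {A : V → Type*} {B : Type*} (κ : CellCode V A B) (Γ : SimpleGraph V)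
variable {x y z : ℤ → B} {v u w : V} {i j N m : ℤ}

/-- No cell crosses the position `N`, and two cells that meet there have different types that are
not adjacent. -/
def Separates (x : ℤ → B) (N : ℤ) : Prop :=
  (∀ u i, κ.HasCell x u i → i < N → i + κ.len u ≤ N) ∧
    ∀ u v i, κ.HasCell x u i → i + κ.len u = N → κ.HasCell x v N → u ≠ v ∧ ¬ Γ.Adj u v

variable {κ Γ}

section left

variable (hx : κ.Separates Γ x N) (hz : κ.Separates Γ z N) (hxz : ∀ j < N, x j = z j)
include hx hxz

theorem HasCell.of_eq_left (h : κ.HasCell x u i) (hi : i < N) : κ.HasCell z u i := by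
  have := hx.1 _ _ h hi
  exact (hasCell_congr fun j _ _ => hxz j (by omega)).mp h

theorem content_eq_left [∀ v, Nonempty (A v)] (h : κ.HasCell x v i) (hi : i < N) :
    κ.content x v i = κ.content z v i := by
  have := hx.1 _ _ h hi
  exact content_congr fun _ => occurs_congr fun j _ _ => hxz j (by omega)

include hz

theorem Alive.of_eq_left (h : κ.Alive Γ x v i) (hi : i < N) : κ.Alive Γ z v i := by
  have hxz' : ∀ j < N, z j = x j := fun j hj => (hxz j hj).symm
  have hv := h.1.of_eq_left hx hxz hi
  refine ⟨hv, fun u huv hr => ⟨fun hu => (h.2 u huv hr).1 ?_, fun hu => ?_⟩⟩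
  · have := κ.two_le_len u
    exact hu.of_eq_left hz hxz' (by omega)
  · rcases (hz.1 _ _ hv hi).lt_or_eq with h' | h'
    · exact (h.2 u huv hr).2 (hu.of_eq_left hz hxz' h')
    · exact (hz.2 _ _ _ hv h' (h' ▸ hu)).2 huv.symm

theorem Active.of_eq_left (h : κ.Active Γ x v i) (hi : i < N) : κ.Active Γ z v i := by
  have := κ.two_le_len v
  refine ⟨h.1.of_eq_left hx hz hxz hi, ?_⟩
  rw [← hxz _ (by omega)]
  exact h.2.imp_left fun h => h.of_eq_left hx hz hxz (by omega)

end left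

theorem Separates.active_add_lt (hx : κ.Separates Γ x N) (h : κ.Active Γ x v i)
    (h' : κ.Active Γ x v (i + κ.len v)) (hi : i < N) : i + κ.len v < N := by
  refine lt_of_le_of_ne (hx.1 _ _ h.hasCell hi) fun e => ?_
  exact (hx.2 _ _ _ h.hasCell e (e ▸ h'.hasCell)).1 rfl

theorem Separates.le_active_sub (hx : κ.Separates Γ x N) (h : κ.HasCell x v i)
    (h' : κ.HasCell x v (i - κ.len v)) (hi : N ≤ i) : N ≤ i - κ.len v := by
  by_contra hlt
  have := hx.1 _ _ h' (by omega)
  rw [sub_add_cancel] at this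
  obtain rfl : N = i := by omega
  exact (hx.2 _ _ _ h' (by omega) h).1 rfl

section right

variable (hx : κ.Separates Γ x N) (hz : κ.Separates Γ z N) (hxz : ∀ j, N ≤ j → x j = z j)
include hxz

theorem HasCell.of_eq_right (h : κ.HasCell x u i) (hi : N ≤ i) : κ.HasCell z u i :=
  (hasCell_congr fun j _ _ => hxz j (by omega)).mp h

include hz

theorem Alive.of_eq_right (h : κ.Alive Γ x v i) (hi : N ≤ i) : κ.Alive Γ z v i := by
  have hxz' : ∀ j, N ≤ j → z j = x j := fun j hj => (hxz j hj).symm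
  have hv := h.1.of_eq_right hxz hi
  refine ⟨hv, fun u huv hr => ⟨fun hu => ?_, fun hu => (h.2 u huv hr).2 ?_⟩⟩
  · by_cases h' : N ≤ i - κ.len u
    · exact (h.2 u huv hr).1 (hu.of_eq_right hxz' h')
    · have := hz.1 _ _ hu (by omega)
      rw [sub_add_cancel] at this
      obtain rfl : N = i := by omega
      exact (hz.2 _ _ _ hu (by omega) hv).2 huv
  · have := κ.two_le_len v
    exact hu.of_eq_right hxz' (by omega)

include hx

theorem Active.of_eq_right (hN : κ.HasCell x w N) (hb : x (N - 2) = κ.on → z (N - 2) = κ.on)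
    (h : κ.Active Γ x v i) (hi : N ≤ i) : κ.Active Γ z v i := by
  refine ⟨h.1.of_eq_right hz hxz hi, h.2.imp (fun h' => ?_) fun h' => ?_⟩
  · exact h'.of_eq_right hz hxz (hx.le_active_sub h.hasCell h'.1 hi)
  -- A cell starting at `N + 1` would overlap the one at `N`. So the signal position `i - 2` is
  -- either at least `N`, where the configurations agree, or equal to `N - 2`.
  · rcases hi.lt_or_eq with hlt | rfl
    · have : i ≠ N + 1 := by
        rintro rfl
        have := κ.two_le_len w
        have := κ.two_le_len v
        have := (hN.eq_of_overlap h.hasCell (by omega) (by omega)).1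
        omega
      rwa [← hxz _ (by omega)]
    · exact hb h'

end right

variable [∀ v, Nonempty (A v)] {f : (ℤ → A v) → ℤ → A v}

theorem newCell_congr_of_isolated {S : ℤ → Prop}
    (ha : ∀ i, S i → (κ.Active Γ x v i ↔ κ.Active Γ z v i))
    (hc : ∀ i, S i → κ.Active Γ x v i → κ.content x v i = κ.content z v i)
    (hx : ∀ i, S i → κ.Active Γ x v i → (κ.Active Γ x v (i + κ.len v) → S (i + κ.len v)) ∧
      (κ.Active Γ x v (i - κ.len v) → S (i - κ.len v)))
    (hz : ∀ i, S i → κ.Active Γ z v i → (κ.Active Γ z v (i + κ.len v) → S (i + κ.len v)) ∧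
      (κ.Active Γ z v (i - κ.len v) → S (i - κ.len v)))
    (hi : S i) (hv : κ.Active Γ x v i) : κ.newCell Γ v f x i = κ.newCell Γ v f z i := by
  have hr : ∀ b, κ.reading Γ x v (i, b) = κ.reading Γ z v (i, b) := fun b => by
    funext k
    obtain ⟨h₁, h₂⟩ := beltPerm_zpow_eq_of_isolated (n := (i, b)) ha hx hz hi hv k
    have h₃ := active_belt_zpow (n := (i, b)) hv k
    unfold reading
    unfold belt at h₃ ⊢
    rw [← h₂, hc _ h₁ h₃]
  simp only [newCell, hr, hc i hi hv]

/-- Left of a separating position, `onBelts` only depends on the configuration left of it. -/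
theorem onBelts_eq_left (hx : κ.Separates Γ x N) (hz : κ.Separates Γ z N)
    (hxz : ∀ j < N, x j = z j) (hj : j < N) : κ.onBelts Γ v f x j = κ.onBelts Γ v f z j := by
  have hxz' : ∀ j < N, z j = x j := fun j hj => (hxz j hj).symm
  have ha : ∀ i < N, (κ.Active Γ x v i ↔ κ.Active Γ z v i) := fun i hi =>
    ⟨fun h => h.of_eq_left hx hz hxz hi, fun h => h.of_eq_left hz hx hxz' hi⟩
  have hlen := κ.two_le_len v
  by_cases h : ∃ i, κ.Active Γ x v i ∧ i ≤ j ∧ j < i + κ.len v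
  · obtain ⟨i, hi, h₁, h₂⟩ := h
    rw [(occurs_onBelts hi).apply h₁ h₂,
      (occurs_onBelts ((ha i (by omega)).mp hi)).apply h₁ h₂,
      newCell_congr_of_isolated (S := (· < N)) ha
        (fun i h hv => content_eq_left hx hxz hv.hasCell h)
        (fun i h hv => ⟨fun hv' => hx.active_add_lt hv hv' h, fun _ => by omega⟩)
        (fun i h hv => ⟨fun hv' => hz.active_add_lt hv hv' h, fun _ => by omega⟩) (by omega) hi]
  · rw [onBelts_apply_of_not fun i a b c => h ⟨i, a, b, c⟩, hxz j hj, onBelts_apply_of_not]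
    exact fun i a b c => h ⟨i, (ha i (by omega)).mpr a, b, c⟩

/-- Right of a separating position, `onBelts` only depends on the configuration right of it and on
the signal there. -/
theorem onBelts_eq_right (hx : κ.Separates Γ x N) (hz : κ.Separates Γ z N)
    (hxz : ∀ j, N ≤ j → x j = z j) (hN : κ.HasCell x w N)
    (hb : x (N - 2) = κ.on ↔ z (N - 2) = κ.on) (hj : N ≤ j) :
    κ.onBelts Γ v f x j = κ.onBelts Γ v f z j := by
  have hxz' : ∀ j, N ≤ j → z j = x j := fun j hj => (hxz j hj).symm
  have ha : ∀ i, N ≤ i → (κ.Active Γ x v i ↔ κ.Active Γ z v i) := fun i hi =>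
    ⟨fun h => h.of_eq_right hx hz hxz hN hb.mp hi,
      fun h => h.of_eq_right hz hx hxz' (hN.of_eq_right hxz le_rfl) hb.mpr hi⟩
  have hlen := κ.two_le_len v
  by_cases h : ∃ i, κ.Active Γ x v i ∧ i ≤ j ∧ j < i + κ.len v
  · obtain ⟨i, hi, h₁, h₂⟩ := h
    have hNi : N ≤ i := by
      by_contra hlt
      have := hx.1 _ _ hi.hasCell (by omega)
      omega
    rw [(occurs_onBelts hi).apply h₁ h₂,
      (occurs_onBelts ((ha i hNi).mp hi)).apply h₁ h₂,
      newCell_congr_of_isolated (S := (N ≤ ·)) ha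
        (fun i h hv => content_congr fun _ => occurs_congr fun j _ _ => hxz j (by omega))
        (fun i h hv => ⟨fun _ => by omega, fun hv' => hx.le_active_sub hv.hasCell hv'.hasCell h⟩)
        (fun i h hv => ⟨fun _ => by omega, fun hv' => hz.le_active_sub hv.hasCell hv'.hasCell h⟩)
        hNi hi]
  · rw [onBelts_apply_of_not fun i a b c => h ⟨i, a, b, c⟩, hxz j hj, onBelts_apply_of_not]
    intro i a b c
    have hNi : N ≤ i := by
      by_contra hlt
      have := hz.1 _ _ a.hasCell (by omega)
      omega
    exact h ⟨i, (ha i hNi).mpr a, b, c⟩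

end CellCode

/-! ### Final segments and their response to the incoming signal. -/

namespace CellCode

variable {V : Type*} {A : V → Type*} {B : Type*} (κ : CellCode V A B) (Γ : SimpleGraph V)
variable {x y z : ℤ → B} {v u w : V} {i j N m : ℤ}

/-- A run of `m` cells of type `v` starts at the separating position `N`, and no cell follows. -/
structure IsSegment (x : ℤ → B) (N : ℤ) (v : V) (m : ℤ) : Prop where
  one_le : 1 ≤ m
  hasCell : ∀ j, 0 ≤ j → j < m → κ.HasCell x v (N + j * κ.len v)
  separates : κ.Separates Γ x N
  lt_of_hasCell : ∀ u i, κ.HasCell x u i → i < N + m * κ.len v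

namespace IsSegment

variable {κ Γ} (h : κ.IsSegment Γ x N v m)
include h

theorem hasCell_start : κ.HasCell x v N := by
  simpa using h.hasCell 0 le_rfl (by linarith [h.one_le])

theorem not_hasCell_left : ¬ κ.HasCell x v (N - κ.len v) := fun h' =>
  (h.separates.2 _ _ _ h' (by omega) h.hasCell_start).1 rfl

theorem not_hasCell_right : ¬ κ.HasCell x u (N + m * κ.len v) := fun h' =>
  lt_irrefl _ (h.lt_of_hasCell _ _ h')

theorem alive (h₀ : 0 ≤ j) (h₁ : j < m) : κ.Alive Γ x v (N + j * κ.len v) := by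
  have hv := κ.two_le_len v
  refine ⟨h.hasCell j h₀ h₁, fun u huv _ => ⟨fun hu => ?_, fun hu => ?_⟩⟩
  · have := κ.two_le_len u
    rcases h₀.eq_or_lt with rfl | h₀
    · exact (h.separates.2 _ _ _ hu (by simp) h.hasCell_start).2 huv
    · have h' := h.hasCell (j - 1) (by omega) (by omega)
      rw [sub_one_mul] at h'
      exact huv.ne (hu.eq_of_overlap h' (by omega) (by omega)).2
  · rw [add_assoc, ← add_one_mul] at hu
    by_cases hj : j + 1 < m
    · have := κ.two_le_len u
      exact huv.ne (hu.eq_of_overlap (h.hasCell (j + 1) (by omega) hj) (by omega) (by omega)).2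
    · obtain rfl : m = j + 1 := by omega
      exact h.not_hasCell_right hu

theorem active_of_pos (h₀ : 0 < j) (h₁ : j < m) : κ.Active Γ x v (N + j * κ.len v) := by
  refine ⟨h.alive h₀.le h₁, Or.inl ?_⟩
  rw [add_sub_assoc, ← sub_one_mul]
  exact h.alive (by omega) (by omega)

theorem active_start_iff : κ.Active Γ x v N ↔ x (N - 2) = κ.on := by
  have := h.alive (j := 0) le_rfl (by linarith [h.one_le])
  rw [zero_mul, add_zero] at this
  simp only [Active, this, true_and, or_iff_right_iff_imp]
  exact fun h' => (h.not_hasCell_left h'.1).elim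

theorem active_of_on (hb : x (N - 2) = κ.on) (h₀ : 0 ≤ j) (h₁ : j < m) :
    κ.Active Γ x v (N + j * κ.len v) := by
  rcases h₀.eq_or_lt with rfl | h₀
  · rwa [zero_mul, add_zero, h.active_start_iff]
  · exact h.active_of_pos h₀ h₁

theorem hasCell_last : κ.HasCell x v (N + (m - 1) * κ.len v) :=
  h.hasCell _ (by linarith [h.one_le]) (by omega)

variable [∀ v, Nonempty (A v)] {f : (ℤ → A v) → ℤ → A v}

omit h in
theorem signal_onBelts_iff (ha : κ.Active Γ x v (N + (m - 1) * κ.len v)) :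
    κ.onBelts Γ v f x (N + m * κ.len v - 2) = κ.on ↔
      f (κ.reading Γ x v (N + (m - 1) * κ.len v, true)) 0 =
        (κ.content x v (N + (m - 1) * κ.len v)).2 := by
  have := (occurs_onBelts (f := f) ha).signal_iff
  rwa [add_assoc, ← add_one_mul, sub_add_cancel] at this

theorem signal_iff : x (N + m * κ.len v - 2) = κ.on ↔
    (κ.content x v (N + (m - 1) * κ.len v)).1 true =
      (κ.content x v (N + (m - 1) * κ.len v)).2 := by
  have := h.hasCell_last.occurs_content.signal_iff
  rwa [add_assoc, ← add_one_mul, sub_add_cancel] at this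

/-- With the incoming signal off, the first cell is inactive and the other `m - 1` cells form a
cyclic belt of length `2(m - 1)`, on which `hf` makes `f` trivial. For `m = 1` no cell of the
segment is active. -/
theorem signal_onBelts_of_off
    (hf : 2 ≤ m → ∀ q : ℤ → A v, (∀ k, q (k + 2 * (m - 1)) = q k) → f q 0 = q 0)
    (hb : x (N - 2) ≠ κ.on) : κ.onBelts Γ v f x (N + m * κ.len v - 2) = κ.on ↔
      x (N + m * κ.len v - 2) = κ.on := by
  have hv := κ.two_le_len v
  have hm := h.one_le
  by_cases hm₂ : 2 ≤ m
  · rw [signal_onBelts_iff (h.active_of_pos (by omega) (by omega)), h.signal_iff]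
    have e : N + (m - 1) * κ.len v = N + κ.len v + (m - 1 - 1) * κ.len v := by ring
    have key : ∀ k, (κ.belt Γ x v ^ k) (N + (m - 1) * κ.len v, true) =
        beltNode (N + κ.len v) (κ.len v) (m - 1) k := by
      intro k
      rw [e]
      refine beltPerm_zpow_beltNode (by omega) (fun j h₀ h₁ => ?_) ?_ ?_ k
      · rw [show N + κ.len v + j * κ.len v = N + (j + 1) * κ.len v by ring]
        exact h.active_of_pos (by omega) (by omega)
      · rwa [add_sub_cancel_right, h.active_start_iff]
      · rw [show N + κ.len v + (m - 1) * κ.len v = N + m * κ.len v by ring]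
        exact fun h' => h.not_hasCell_right h'.hasCell
    rw [hf hm₂ _ fun k => by simp only [reading, key, beltNode_add_period]]
    simp [reading]
  · obtain rfl : m = 1 := by omega
    rw [onBelts_apply_of_not]
    intro i hi h₁ h₂
    rw [one_mul] at h₁ h₂
    obtain ⟨rfl, -⟩ := hi.hasCell.eq_of_overlap h.hasCell_start (by omega) (by omega)
    exact hb (h.active_start_iff.mp hi)

/-- All `m` cells form a cyclic belt. The contents in `hx` are laid out so that the node `k` of
`beltNode` carries `p k`; hence the last top symbol is `p 0`, and the action of `f` turns it into `f
p 0`. -/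
theorem signal_onBelts_of_on {p : ℤ → A v} (hp : ∀ k, p (k + 2 * m) = p k)
    (hx : ∀ j, 0 ≤ j → j < m → κ.Occurs x v (N + j * κ.len v)
      (fun b => if b then p (m + 1 + j) else p (m - j), p 0))
    (hb : x (N - 2) = κ.on) : κ.onBelts Γ v f x (N + m * κ.len v - 2) = κ.on ↔ f p 0 = p 0 := by
  have hm := h.one_le
  rw [signal_onBelts_iff (h.active_of_on hb (by omega) (by omega)),
    (hx (m - 1) (by omega) (by omega)).content_eq]
  suffices κ.reading Γ x v (N + (m - 1) * κ.len v, true) = p by rw [this]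
  have hper : ∀ k, p (k % (2 * m)) = p k := by
    have hp' : Function.Periodic p (2 * m) := hp
    intro k
    conv_rhs => rw [← Int.emod_add_mul_ediv k (2 * m), mul_comm (2 * m)]
    exact (hp'.int_mul (k / (2 * m)) _).symm
  funext k
  unfold reading belt
  rw [beltPerm_zpow_beltNode hm (fun j => h.active_of_on hb)
    (fun h' => h.not_hasCell_left h'.hasCell) fun h' => h.not_hasCell_right h'.hasCell]
  have h₀ := Int.emod_nonneg (k - 1) (show 2 * m ≠ 0 by omega)
  have h₁ := Int.emod_lt_of_pos (k - 1) (show 0 < 2 * m by omega)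
  have e : p k = p ((k - 1) % (2 * m) + 1) := by
    rw [← hper ((k - 1) % (2 * m) + 1), Int.emod_add_emod, sub_add_cancel, hper]
  rw [e]
  unfold beltNode
  split_ifs with hr
  · rw [(hx _ (by omega) (by omega)).content_eq]
    simp only [Bool.false_eq_true, if_false]
    congr 1
    omega
  · rw [(hx _ (by omega) (by omega)).content_eq]
    simp only [if_true]
    congr 1
    omega

end IsSegment

/-- Every cell of `y` ends at `N` or to the left of it, and those ending at `N` have a type that is
different from `v` and not adjacent to `v`. -/
def Admits (y : ℤ → B) (N : ℤ) (v : V) : Prop :=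
  ∀ u i, κ.HasCell y u i → i + κ.len u ≤ N ∧ (i + κ.len u = N → u ≠ v ∧ ¬ Γ.Adj u v)

/-- The configuration that agrees with `y` to the left of `N`, followed by the `m` cells
`s 0, …, s (m - 1)` of type `v`, followed by the letter `κ.off`. -/
noncomputable def appendCells (y : ℤ → B) (N : ℤ) (v : V) (m : ℤ) (s : ℤ → BeltCell (A v)) :
    ℤ → B := fun j =>
  if j < N then y j
  else if j < N + m * κ.len v then
    κ.code v (s ((j - N) / κ.len v)) ((j - N) % κ.len v)
  else κ.off

section appendCells

variable {κ Γ} {s : ℤ → BeltCell (A v)}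

theorem appendCells_of_lt (h : j < N) : κ.appendCells y N v m s j = y j := if_pos h

theorem appendCells_congr_right (h : N ≤ j) :
    κ.appendCells y N v m s j = κ.appendCells z N v m s j := by
  simp only [appendCells, h.not_gt, if_false]

theorem occurs_appendCells (h₀ : 0 ≤ j) (h₁ : j < m) :
    κ.Occurs (κ.appendCells y N v m s) v (N + j * κ.len v) (s j) := by
  intro k hk₀ hk₁
  have hv := κ.two_le_len v
  have h₂ : 0 ≤ j * κ.len v := by positivity
  have h₃ : (j + 1) * κ.len v ≤ m * κ.len v := by gcongr; omega
  rw [add_one_mul] at h₃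
  have e : N + j * κ.len v + k - N = k + j * κ.len v := by ring
  rw [appendCells, if_neg (by omega), if_pos (by omega), e, Int.add_mul_ediv_right _ _ (by omega),
    Int.ediv_eq_zero_of_lt hk₀ hk₁, zero_add, Int.add_mul_emod_self_right,
    Int.emod_eq_of_lt hk₀ hk₁]

theorem appendCells_of_le (h : N + m * κ.len v ≤ j) (hm : 0 ≤ m) :
    κ.appendCells y N v m s j = κ.off := by
  have hv := κ.two_le_len v
  have : 0 ≤ m * κ.len v := by positivity
  rw [appendCells, if_neg (by omega), if_neg (by omega)]

theorem hasCell_appendCells_cases (hm : 1 ≤ m)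
    (h : κ.HasCell (κ.appendCells y N v m s) u i) :
    (i + κ.len u ≤ N ∧ κ.HasCell y u i) ∨
      (u = v ∧ N ≤ i ∧ i + κ.len u ≤ N + m * κ.len v) := by
  have hu := κ.two_le_len u
  have hv := κ.two_le_len v
  by_cases h₁ : i + κ.len u ≤ N
  · exact Or.inl ⟨h₁, (hasCell_congr fun j _ _ => appendCells_of_lt (by omega)).mp h⟩
  · right
    have h₂ : i < N + m * κ.len v := by
      by_contra h₂
      have := h.apply_zero
      rw [appendCells_of_le (by omega) (by omega)] at this
      exact κ.on_ne_off this.symm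
    have hc : ∀ t, N ≤ t → t < N + m * κ.len v →
        ∃ j, 0 ≤ j ∧ j < m ∧ N + j * κ.len v ≤ t ∧ t < N + j * κ.len v + κ.len v := by
      intro t ht₀ ht₁
      have e := Int.emod_add_mul_ediv (t - N) (κ.len v)
      have e₁ := Int.emod_nonneg (t - N) (show κ.len v ≠ 0 by omega)
      have e₂ := Int.emod_lt_of_pos (t - N) (show 0 < κ.len v by omega)
      have e₃ := Int.ediv_nonneg (show 0 ≤ t - N by omega) (show 0 ≤ κ.len v by omega)
      rw [mul_comm] at e
      refine ⟨(t - N) / κ.len v, e₃, ?_, by omega, by omega⟩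
      rw [Int.ediv_lt_iff_lt_mul (by omega)]
      omega
    -- The position `max i N` lies both in the given cell and in the appended block, so the given
    -- cell overlaps, and thus equals, one of the appended cells.
    obtain ⟨j, hj₀, hj₁, hj₂, hj₃⟩ := hc (max i N) (le_max_right _ _) (by
      have : 0 < m * κ.len v := by positivity
      omega)
    obtain ⟨rfl, rfl⟩ := h.eq_of_overlap (occurs_appendCells hj₀ hj₁).hasCell (by omega) (by omega)
    have h₃ : (j + 1) * κ.len u ≤ m * κ.len u := by gcongr; omega
    rw [add_one_mul] at h₃
    have : 0 ≤ j * κ.len u := by positivity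
    exact ⟨rfl, by omega, by omega⟩

theorem isSegment_appendCells (hm : 1 ≤ m) (hy : κ.Admits Γ y N v) :
    κ.IsSegment Γ (κ.appendCells y N v m s) N v m := by
  refine ⟨hm, fun j h₀ h₁ => (occurs_appendCells h₀ h₁).hasCell, ⟨fun u i h hi => ?_, ?_⟩, ?_⟩
  · rcases hasCell_appendCells_cases hm h with h' | h'
    · exact h'.1
    · omega
  · intro u w i hu hi hw
    have hlu := κ.two_le_len u
    have hlw := κ.two_le_len w
    obtain rfl : w = v := by
      rcases hasCell_appendCells_cases hm hw with h' | h'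
      · omega
      · exact h'.1
    rcases hasCell_appendCells_cases hm hu with h' | h'
    · exact (hy u i h'.2).2 hi
    · omega
  · intro u i h
    have hlu := κ.two_le_len u
    have hlv := κ.two_le_len v
    have : 0 < m * κ.len v := by positivity
    rcases hasCell_appendCells_cases hm h with h' | h' <;> omega

end appendCells

end CellCode

/-! ### Reduced words and periodic points. -/

/-- A word in which no two syllables of the same type can be moved next to each other by exchanging
neighbouring syllables of adjacent types. -/
def SimpleGraph.IsReducedWord {V : Type*} (Γ : SimpleGraph V) (l : List V) : Prop :=
  ∀ a v r b, l = a ++ v :: (r ++ v :: b) → ∃ t ∈ r, ¬ Γ.Adj t v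

namespace FullShiftAut

open Filter Topology

variable {A : Type*} [TopologicalSpace A] [DiscreteTopology A]

/-- The points of even period are dense, so that a nontrivial automorphism moves one of them. -/
theorem exists_periodic_apply_ne {f : FullShiftAut A} (hf : f ≠ 1) :
    ∃ m : ℕ, 1 ≤ m ∧ ∃ p : ℤ → A, (∀ k, p (k + 2 * m) = p k) ∧ f.1 p 0 ≠ p 0 := by
  obtain ⟨q, hq⟩ : ∃ q : ℤ → A, f.1 q 0 ≠ q 0 := by
    by_contra! h
    refine hf (Subtype.ext (Homeomorph.ext fun q => funext fun k => ?_))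
    have := h fun l => q (l + k)
    rwa [apply_add, zero_add] at this
  -- The window of `q` on `[-m, m)`, repeated with period `2m`; these points converge to `q`.
  set p : ℕ → ℤ → A := fun m k => q ((k + m) % (2 * m) - m) with hp
  have hpq : ∀ k, ∀ᶠ m in atTop, p m k = q k := by
    intro k
    filter_upwards [eventually_gt_atTop k.natAbs] with m hm
    simp only [hp]
    rw [Int.emod_eq_of_lt (by omega) (by omega), add_sub_cancel_right]
  have hlim : Tendsto p atTop (𝓝 q) :=
    tendsto_pi_nhds.mpr fun k => tendsto_const_nhds.congr' <|
      (hpq k).mono fun m hm => hm.symm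
  have hf₀ : ∀ᶠ m in atTop, f.1 (p m) 0 = f.1 q 0 :=
    (((continuous_apply 0).comp f.1.continuous).continuousAt.tendsto.comp hlim).eventually_mem
      ((isOpen_discrete {f.1 q 0}).mem_nhds rfl)
  obtain ⟨m, h₁, h₂, h₃⟩ := (hf₀.and ((hpq 0).and (eventually_ge_atTop 1))).exists
  refine ⟨m, h₃, p m, fun k => ?_, by rwa [h₁, h₂]⟩
  simp only [hp]
  rw [add_right_comm, Int.add_emod_right]

/-- The minimal `m` is the length of the segment that detects `f`: removing one cell, as a missing
signal does, leaves a belt on which `f` is trivial. -/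
theorem exists_minimal_periodic_apply_ne {f : FullShiftAut A} (hf : f ≠ 1) :
    ∃ m : ℤ, 1 ≤ m ∧ (∃ p : ℤ → A, (∀ k, p (k + 2 * m) = p k) ∧ f.1 p 0 ≠ p 0) ∧
      (2 ≤ m → ∀ q : ℤ → A, (∀ k, q (k + 2 * (m - 1)) = q k) → f.1 q 0 = q 0) := by
  classical
  have h := exists_periodic_apply_ne hf
  refine ⟨Nat.find h, by exact_mod_cast (Nat.find_spec h).1, (Nat.find_spec h).2, ?_⟩
  intro hm q hq
  by_contra hne
  have hm' : 2 ≤ Nat.find h := by exact_mod_cast hm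
  refine Nat.find_min h (m := Nat.find h - 1) (by omega) ⟨by omega, q, fun k => ?_, hne⟩
  rw [Nat.cast_sub (by omega)]
  exact hq k

end FullShiftAut

/-! ### Propagation of a difference of signals along a reduced word. -/

namespace CellCode

variable {V : Type*} {A : V → Type*} {B : Type*} (κ : CellCode V A B) (Γ : SimpleGraph V)
variable {x x' y z : ℤ → B} {v u w : V} {i j N : ℤ}

/-- Every cell of `x` ends at `N` or to the left of it, and the cells ending at `N`, of which there
is one, have type `v`. -/
def EndsWith (x : ℤ → B) (N : ℤ) (v : V) : Prop :=
  κ.HasCell x v (N - κ.len v) ∧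
    ∀ u i, κ.HasCell x u i → i + κ.len u ≤ N ∧ (i + κ.len u = N → u = v)

variable {κ Γ}

theorem EndsWith.admits (h : κ.EndsWith x N u) (hne : u ≠ v) (hadj : ¬ Γ.Adj u v) :
    κ.Admits Γ x N v := fun w i hw =>
  ⟨(h.2 w i hw).1, fun e => by rw [(h.2 w i hw).2 e]; exact ⟨hne, hadj⟩⟩

theorem Admits.separates (h : κ.Admits Γ x N v) : κ.Separates Γ x N :=
  ⟨fun u i hu _ => (h u i hu).1, fun u w i _ _ hw => by
    have := (h w N hw).1
    have := κ.two_le_len w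
    omega⟩

theorem endsWith_appendCells {m : ℤ} {s : ℤ → BeltCell (A v)} (hm : 1 ≤ m) :
    κ.EndsWith (κ.appendCells y N v m s) (N + m * κ.len v) v := by
  have hv := κ.two_le_len v
  have : 0 < m * κ.len v := by positivity
  refine ⟨?_, fun u i h => ?_⟩
  · rw [add_sub_assoc, ← sub_one_mul]
    exact (occurs_appendCells (by omega) (by omega)).hasCell
  · rcases hasCell_appendCells_cases hm h with h' | h'
    · exact ⟨by omega, fun _ => by omega⟩
    · exact ⟨h'.2.2, fun _ => h'.1⟩

variable [∀ v, Nonempty (A v)]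

theorem onBelts_eq_of_hasCell {f : (ℤ → A u) → ℤ → A u} (hne : u ≠ v)
    (h : ∀ w i, κ.HasCell x w i → i ≤ j → j < i + κ.len w → w = v) :
    κ.onBelts Γ u f x j = x j :=
  onBelts_apply_of_not fun i hi h₁ h₂ => hne (h u i hi.hasCell h₁ h₂)

/-- The signal of the last cell of a segment is only changed by the automorphisms of its type. -/
theorem EndsWith.onBelts_signal {f : (ℤ → A u) → ℤ → A u} (h : κ.EndsWith x N v) (hne : u ≠ v) :
    κ.onBelts Γ u f x (N - 2) = x (N - 2) := by
  have hv := κ.two_le_len v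
  exact onBelts_eq_of_hasCell hne fun w i hw h₁ h₂ =>
    (hw.eq_of_overlap h.1 (by omega) (by omega)).2

variable [TopologicalSpace B] [DiscreteTopology B]
  [∀ v, TopologicalSpace (A v)] [∀ v, DiscreteTopology (A v)]

variable (κ Γ) in
/-- The action on `B^ℤ` of a product of automorphisms of full shifts over the alphabets `A v`. -/
noncomputable def wordAct (l : List (Σ v, FullShiftAut (A v))) : FullShiftAut B :=
  (l.map fun s => κ.beltHom Γ s.1 s.2).prod

variable {l : List (Σ v, FullShiftAut (A v))} {s : Σ v, FullShiftAut (A v)}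

theorem wordAct_cons : (κ.wordAct Γ (s :: l)).1 x =
    κ.onBelts Γ s.1 s.2.1 ((κ.wordAct Γ l).1 x) := rfl

theorem wordAct_eq_onBelts_cons : (κ.wordAct Γ l).1 x =
    κ.onBelts Γ s.1 (s.2⁻¹).1 ((κ.wordAct Γ (s :: l)).1 x) := by
  rw [wordAct_cons, ← onBelts_mul, inv_mul_cancel]
  exact onBelts_id.symm

theorem hasCell_wordAct : κ.HasCell ((κ.wordAct Γ l).1 x) v i ↔ κ.HasCell x v i := by
  induction l with
  | nil => exact Iff.rfl
  | cons s l ih => rw [wordAct_cons, hasCell_onBelts, ih]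

theorem separates_wordAct : κ.Separates Γ ((κ.wordAct Γ l).1 x) N ↔ κ.Separates Γ x N := by
  simp only [Separates, hasCell_wordAct]

theorem admits_wordAct : κ.Admits Γ ((κ.wordAct Γ l).1 x) N v ↔ κ.Admits Γ x N v := by
  simp only [Admits, hasCell_wordAct]

theorem endsWith_wordAct : κ.EndsWith ((κ.wordAct Γ l).1 x) N v ↔ κ.EndsWith x N v := by
  simp only [EndsWith, hasCell_wordAct]

/-- Pull the appended segments `Y` and `Y'` back along the word `l`. Left of `N` this gives the
orbits of `x` and `x'`. Right of `N` the two orbits agree. -/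
theorem wordAct_pullback {Y Y' Z Z' : ℤ → B} {m : ℕ} (hx : κ.Separates Γ x N)
    (hx' : κ.Separates Γ x' N) (hY : κ.Separates Γ Y N) (hY' : κ.Separates Γ Y' N)
    (hN : κ.HasCell Y v N) (hc : ∀ w i, κ.HasCell Y w i → N < i + κ.len w → w = v)
    (hc' : ∀ w i, κ.HasCell Y' w i → N < i + κ.len w → w = v)
    (hl : ∀ j < N, Y j = (κ.wordAct Γ l).1 x j) (hl' : ∀ j < N, Y' j = (κ.wordAct Γ l).1 x' j)
    (hr : ∀ j, N ≤ j → Y j = Y' j)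
    (hZ : (κ.wordAct Γ l).1 Z = Y) (hZ' : (κ.wordAct Γ l).1 Z' = Y')
    (htype : ∀ a s b, l = a ++ s :: b → m ≤ b.length + 1 → s.1 ≠ v)
    (hagree : ∀ a b, l = a ++ b → b.length < m →
      ((κ.wordAct Γ b).1 x (N - 2) = κ.on ↔ (κ.wordAct Γ b).1 x' (N - 2) = κ.on))
    (a b : List (Σ v, FullShiftAut (A v))) (hab : l = a ++ b) :
    (∀ j < N, (κ.wordAct Γ b).1 Z j = (κ.wordAct Γ b).1 x j) ∧
      (∀ j < N, (κ.wordAct Γ b).1 Z' j = (κ.wordAct Γ b).1 x' j) ∧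
      ∀ j, N ≤ j → (κ.wordAct Γ b).1 Z j = (κ.wordAct Γ b).1 Z' j := by
  subst hZ hZ'
  simp only [separates_wordAct, hasCell_wordAct] at hY hY' hN hc hc'
  induction a using List.reverseRecOn generalizing b with
  | nil =>
    obtain rfl : l = b := hab
    exact ⟨hl, hl', hr⟩
  | append_singleton a s ih =>
    rw [List.append_assoc, List.singleton_append] at hab
    obtain ⟨h₁, h₂, h₃⟩ := ih _ hab
    refine ⟨fun j hj => ?_, fun j hj => ?_, fun j hj => ?_⟩
    · rw [wordAct_eq_onBelts_cons (s := s) (x := Z), wordAct_eq_onBelts_cons (s := s) (x := x)]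
      exact onBelts_eq_left (separates_wordAct.mpr hY) (separates_wordAct.mpr hx) h₁ hj
    · rw [wordAct_eq_onBelts_cons (s := s) (x := Z'), wordAct_eq_onBelts_cons (s := s) (x := x')]
      exact onBelts_eq_left (separates_wordAct.mpr hY') (separates_wordAct.mpr hx') h₂ hj
    · rw [wordAct_eq_onBelts_cons (s := s) (x := Z), wordAct_eq_onBelts_cons (s := s) (x := Z')]
      -- As long as the signals at `N` agree, the two right halves evolve alike. In the remaining
      -- stages the syllable is not of type `v`, while all cells reaching beyond `N` are, so nothing
      -- changes there.
      by_cases hm : (s :: b).length < m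
      · refine onBelts_eq_right (separates_wordAct.mpr hY) (separates_wordAct.mpr hY') h₃
          (hasCell_wordAct.mpr hN) ?_ hj
        rw [h₁ _ (by omega), h₂ _ (by omega)]
        exact hagree _ _ hab hm
      · have hne := htype _ _ _ hab (by simpa using hm)
        rw [onBelts_eq_of_hasCell hne, onBelts_eq_of_hasCell hne, h₃ j hj]
        · exact fun w i hw _ _ => hc' w i (hasCell_wordAct.mp hw) (by omega)
        · exact fun w i hw _ _ => hc w i (hasCell_wordAct.mp hw) (by omega)

/-- Two configurations whose signals at `N` differ after `l` can be extended by a segment of type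
`v` whose final signals differ after the further application of `f`, but not before. -/
theorem exists_extension {f : FullShiftAut (A v)} (hf : f ≠ 1) {m : ℕ} (hx : κ.Admits Γ x N v)
    (hx' : κ.Admits Γ x' N v) (htype : ∀ a s b, l = a ++ s :: b → m ≤ b.length + 1 → s.1 ≠ v)
    (hagree : ∀ a b, l = a ++ b → b.length < m →
      ((κ.wordAct Γ b).1 x (N - 2) = κ.on ↔ (κ.wordAct Γ b).1 x' (N - 2) = κ.on))
    (hdiff : ¬ ((κ.wordAct Γ l).1 x (N - 2) = κ.on ↔ (κ.wordAct Γ l).1 x' (N - 2) = κ.on)) :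
    ∃ (M : ℤ) (z z' : ℤ → B), κ.EndsWith z M v ∧ κ.EndsWith z' M v ∧
      (∀ a b, l = a ++ b →
        ((κ.wordAct Γ b).1 z (M - 2) = κ.on ↔ (κ.wordAct Γ b).1 z' (M - 2) = κ.on)) ∧
      ¬ ((κ.wordAct Γ (⟨v, f⟩ :: l)).1 z (M - 2) = κ.on ↔
        (κ.wordAct Γ (⟨v, f⟩ :: l)).1 z' (M - 2) = κ.on) := by
  obtain ⟨q, hq, ⟨p, hp, hfp⟩, hmin⟩ := FullShiftAut.exists_minimal_periodic_apply_ne hf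
  -- The layout required by `signal_onBelts_of_on`. The last top symbol is `p (2 * q) = p 0`, the
  -- reference symbol, so the final signal is on before `f` acts.
  set c : ℤ → BeltCell (A v) := fun j => (fun b => if b then p (q + 1 + j) else p (q - j), p 0)
  set Y := κ.appendCells ((κ.wordAct Γ l).1 x) N v q c with hYdef
  set Y' := κ.appendCells ((κ.wordAct Γ l).1 x') N v q c with hYdef'
  have hY : κ.IsSegment Γ Y N v q := isSegment_appendCells hq (admits_wordAct.mpr hx)
  have hY' : κ.IsSegment Γ Y' N v q := isSegment_appendCells hq (admits_wordAct.mpr hx')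
  have hv := κ.two_le_len v
  have hqv : κ.len v ≤ q * κ.len v := le_mul_of_one_le_left (by omega) hq
  -- The segment is prescribed after the action of `l`; the initial configurations are its preimages
  -- under `l`.
  have hZ : (κ.wordAct Γ l).1 ((κ.wordAct Γ l).1.symm Y) = Y := Homeomorph.apply_symm_apply _ _
  have hZ' : (κ.wordAct Γ l).1 ((κ.wordAct Γ l).1.symm Y') = Y' := Homeomorph.apply_symm_apply _ _
  have hcell : ∀ y w i, κ.HasCell (κ.appendCells y N v q c) w i → N < i + κ.len w → w = v := by
    intro y w i hw hi
    rcases hasCell_appendCells_cases hq hw with h | h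
    · omega
    · exact h.1
  -- The segment negates the signal: an incoming `on` lets `f` destroy the equality with the
  -- reference symbol, and otherwise the equality persists.
  have key : ∀ y, κ.Admits Γ y N v →
      (κ.onBelts Γ v f.1 (κ.appendCells y N v q c) (N + q * κ.len v - 2) = κ.on ↔
        ¬ y (N - 2) = κ.on) := by
    intro y hy
    have hS := isSegment_appendCells (s := c) hq hy
    have e : κ.appendCells y N v q c (N - 2) = y (N - 2) := appendCells_of_lt (by omega)
    by_cases hb : y (N - 2) = κ.on
    · rw [hS.signal_onBelts_of_on hp (fun j h₀ h₁ => occurs_appendCells h₀ h₁) (e.trans hb)]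
      simp only [hfp, hb, not_true]
    · rw [hS.signal_onBelts_of_off hmin (by rwa [e]), hS.signal_iff,
        (occurs_appendCells (by omega) (by omega)).content_eq]
      simp only [c, if_true, hb, not_false_eq_true, iff_true]
      rw [← hp 0]
      congr 1
      ring
  refine ⟨N + q * κ.len v, (κ.wordAct Γ l).1.symm Y, (κ.wordAct Γ l).1.symm Y', ?_, ?_, ?_, ?_⟩
  · rw [← endsWith_wordAct (Γ := Γ) (l := l), hZ]
    exact endsWith_appendCells hq
  · rw [← endsWith_wordAct (Γ := Γ) (l := l), hZ']
    exact endsWith_appendCells hq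
  · intro a b hab
    rw [(wordAct_pullback hx.separates hx'.separates hY.separates hY'.separates hY.hasCell_start
      (hcell _) (hcell _) (fun j hj => appendCells_of_lt hj) (fun j hj => appendCells_of_lt hj)
      (fun j hj => appendCells_congr_right hj) hZ hZ' htype hagree a b hab).2.2 _ (by omega)]
  · rw [wordAct_cons, wordAct_cons, hZ, hZ']
    dsimp only
    rw [hYdef, hYdef', key _ (admits_wordAct.mpr hx), key _ (admits_wordAct.mpr hx'), not_iff_not]
    exact hdiff

/-- The word acts from right to left, so `b` acts first. The syllable `s` is the one served by the
last segment, and up to its action the signals agree. The syllables of `r` act later and are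
adjacent to `s`, so they preserve the difference. Keeping this decomposition is what lets
reducedness rule out a next syllable of the type of `s`. -/
theorem exists_signals_ne (hl : Γ.IsReducedWord (l.map Sigma.fst)) (h₁ : ∀ s ∈ l, s.2 ≠ 1)
    (hne : l ≠ []) :
    ∃ r s b N x x', l = r ++ s :: b ∧ (∀ t ∈ r, Γ.Adj t.1 s.1) ∧
      κ.EndsWith x N s.1 ∧ κ.EndsWith x' N s.1 ∧
      (∀ a c, l = a ++ c → c.length ≤ b.length →
        ((κ.wordAct Γ c).1 x (N - 2) = κ.on ↔ (κ.wordAct Γ c).1 x' (N - 2) = κ.on)) ∧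
      ¬ ((κ.wordAct Γ l).1 x (N - 2) = κ.on ↔ (κ.wordAct Γ l).1 x' (N - 2) = κ.on) := by
  induction l with
  | nil => exact (hne rfl).elim
  | cons t l ih =>
    obtain ⟨v, f⟩ := t
    have hf : f ≠ 1 := h₁ ⟨v, f⟩ List.mem_cons_self
    by_cases hl₀ : l = []
    · subst hl₀
      -- A cell starts with two letters `on`, so a configuration with at most one `on` contains no
      -- cell. The two starting configurations differ in the signal at `-2` only.
      have hno : ∀ (b : B) (u : V) (i : ℤ),
          ¬ κ.HasCell (fun j => if j = -2 then b else κ.off) u i := by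
        intro b u i h
        have h₀ := h.apply_zero
        have h₁ := h.apply_one
        split_ifs at h₀ h₁
        · omega
        · exact κ.on_ne_off h₁.symm
        · exact κ.on_ne_off h₀.symm
        · exact κ.on_ne_off h₀.symm
      obtain ⟨M, z, z', hz, hz', hag, hdi⟩ := exists_extension (κ := κ) (Γ := Γ) (l := []) (m := 0)
        (N := 0) (x := fun j => if j = -2 then κ.on else κ.off)
        (x' := fun j => if j = -2 then κ.off else κ.off) hf
        (fun u i h => (hno _ u i h).elim) (fun u i h => (hno _ u i h).elim)
        (by simp) (fun _ _ _ h => (Nat.not_lt_zero _ h).elim) (by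
          change ¬ ((if (0 - 2 : ℤ) = -2 then κ.on else κ.off) = κ.on ↔
            (if (0 - 2 : ℤ) = -2 then κ.off else κ.off) = κ.on)
          simp [κ.on_ne_off.symm])
      refine ⟨[], ⟨v, f⟩, [], M, z, z', rfl, by simp, hz, hz', fun a c _ hc => ?_, hdi⟩
      obtain rfl : c = [] := by simpa using hc
      exact hag [] [] rfl
    · obtain ⟨r, s, b, N, x, x', rfl, hr, hx, hx', hag, hdi⟩ := ih
        (fun a w r b e => hl (v :: a) w r b (by rw [List.map_cons, e]; rfl))
        (fun s hs => h₁ s (List.mem_cons_of_mem _ hs)) hl₀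
      by_cases hvs : v = s.1
      -- Everything between the two syllables of type `v` is adjacent to `v`, against reducedness.
      · obtain ⟨t, ht, hadj⟩ := hl [] v (r.map Sigma.fst) (b.map Sigma.fst) (by simp [hvs])
        obtain ⟨t', ht', rfl⟩ := List.mem_map.mp ht
        exact (hadj (hvs ▸ hr t' ht')).elim
      by_cases hadj : Γ.Adj v s.1
      · refine ⟨⟨v, f⟩ :: r, s, b, N, x, x', rfl, ?_, hx, hx', fun a c e hc => ?_, ?_⟩
        · rintro t (_ | ⟨_, ht⟩)
          · exact hadj
          · exact hr t ht
        · cases a with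
          | nil =>
            have := congrArg List.length e
            simp at this
            omega
          | cons t a => exact hag a c (List.cons.inj e).2 hc
        · rw [wordAct_cons, wordAct_cons, (endsWith_wordAct.mpr hx).onBelts_signal hvs,
            (endsWith_wordAct.mpr hx').onBelts_signal hvs]
          exact hdi
      · have htype : ∀ a t c, r ++ s :: b = a ++ t :: c → b.length + 1 ≤ c.length + 1 →
            t.1 ≠ v := by
          intro a t c e hc
          have hpre : a ++ [t] <+: r ++ [s] := by
            refine List.prefix_of_prefix_length_le (l₃ := r ++ s :: b)
              ⟨c, by rw [e]; simp⟩ ⟨b, by simp⟩ ?_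
            have := congrArg List.length e
            simp at this ⊢
            omega
          have ht : t ∈ r ++ [s] := hpre.subset (by simp)
          rcases List.mem_append.mp ht with ht | ht
          · rintro rfl
            exact hadj (hr t ht)
          · obtain rfl : t = s := by simpa using ht
            exact Ne.symm hvs
        obtain ⟨M, z, z', hz, hz', hag', hdi'⟩ := exists_extension hf
          (hx.admits (Ne.symm hvs) fun h => hadj h.symm)
          (hx'.admits (Ne.symm hvs) fun h => hadj h.symm) htype
          (fun a c e hc => hag a c e (by omega)) hdi
        refine ⟨[], ⟨v, f⟩, _, M, z, z', rfl, by simp, hz, hz', fun a c e hc => ?_, hdi'⟩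
        cases a with
        | nil =>
          have e' : _ = c := e
          rw [← e', List.length_cons] at hc
          omega
        | cons t a => exact hag' a c (List.cons.inj e).2

theorem wordAct_ne_one (hl : Γ.IsReducedWord (l.map Sigma.fst)) (h₁ : ∀ s ∈ l, s.2 ≠ 1)
    (hne : l ≠ []) : κ.wordAct Γ l ≠ 1 := by
  obtain ⟨r, s, b, N, x, x', -, -, -, -, hag, hdi⟩ := exists_signals_ne (κ := κ) hl h₁ hne
  intro h
  refine hdi ?_
  rw [h]
  exact hag l [] (List.append_nil l).symm (Nat.zero_le _)

end CellCode

/-! ### A cell code over two letters. -/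

section code

/-- The positions of the letter `on` in the code word
`1 1 0 (1 0)ⁿ 0 0 w₀ 0 w₁ 0 … w_{m-1} 0 d 0` with `w_t = 1`, the other `w_i = 0`, and `d = δ`. -/
def IsCodeOne (n m t δ k : ℤ) : Prop :=
  k = 0 ∨ k = 1 ∨ (k % 2 = 1 ∧ 3 ≤ k ∧ k < 2 * n + 3) ∨ k = 2 * (n + 1 + t) + 3 ∨
    (k = 2 * (n + 1 + m) + 3 ∧ δ = 1)

/-- Apart from position `0`, every `on` sits at an odd position, so two consecutive letters `on`
occur only at the start and the overlapping words are aligned. Then the first odd position with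
letter `off`, which is `2 * n + 3`, reveals `n`. -/
theorem isCodeOne_overlap {n m t δ n' m' t' δ' s : ℤ} (hn : 0 ≤ n) (ht : 0 ≤ t) (htm : t < m)
    (hn' : 0 ≤ n') (ht' : 0 ≤ t') (htm' : t' < m') (hs : 0 ≤ s) (hs' : s < 2 * n + 2 * m + 7)
    (h : ∀ k, s ≤ k → k < 2 * n + 2 * m + 7 → k < s + (2 * n' + 2 * m' + 7) →
      (IsCodeOne n m t δ k ↔ IsCodeOne n' m' t' δ' (k - s))) : s = 0 ∧ n = n' := by
  unfold IsCodeOne at h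
  obtain rfl : s = 0 := by
    by_contra hs₀
    have h₀ := h s le_rfl hs' (by omega)
    by_cases h₁ : s + 1 < 2 * n + 2 * m + 7
    · have h₂ := h (s + 1) (by omega) h₁ (by omega)
      omega
    · omega
  refine ⟨rfl, ?_⟩
  rcases lt_trichotomy n n' with hlt | heq | hlt
  · have := h (2 * n + 3) (by omega) (by omega) (by omega)
    omega
  · exact heq
  · have := h (2 * n' + 3) (by omega) (by omega) (by omega)
    omega

theorem iff_of_ite_eq_ite {α : Type*} {a b : α} (hab : a ≠ b) {p q : Prop} [Decidable p]
    [Decidable q] (h : (if p then a else b) = if q then a else b) : p ↔ q := by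
  by_cases hp : p <;> by_cases hq : q <;> simp_all [hab.symm]

open Classical in
/-- A cell code over any two distinct letters. -/
noncomputable def CellCode.ofInjective {V : Type*} {A : V → Type*} [∀ v, Finite (A v)] {B : Type*}
    (rank : V → ℕ) (hrank : Function.Injective rank) (on off : B) (hne : on ≠ off) :
    CellCode V A B where
  rank := rank
  rank_injective := hrank
  len v := 2 * rank v + 2 * Nat.card (BeltCell (A v)) + 7
  two_le_len v := by omega
  on := on
  off := off
  on_ne_off := hne
  code v c k := if IsCodeOne (rank v) (Nat.card (BeltCell (A v)))
    (Finite.equivFin (BeltCell (A v)) c : ℕ) (if c.1 true = c.2 then 1 else 0) k then on else off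
  code_zero v c := if_pos (Or.inl rfl)
  code_one v c := if_pos (Or.inr (Or.inl rfl))
  code_last v c := if_neg (by unfold IsCodeOne; have := (Finite.equivFin _ c).2; omega)
  code_signal v c := by
    have := (Finite.equivFin _ c).2
    rw [ite_eq_left_iff]
    by_cases hc : c.1 true = c.2
    · simp only [hc, if_true, iff_true]
      intro h
      refine (h ?_).elim
      unfold IsCodeOne
      omega
    · simp only [hc, if_false, iff_false]
      intro h
      refine hne (h ?_).symm
      unfold IsCodeOne
      omega
  eq_of_overlap {v u c d s} hs hs' h := by
    have hc := (Finite.equivFin _ c).2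
    have hd := (Finite.equivFin _ d).2
    have := isCodeOne_overlap (n := rank v) (n' := rank u) (m := Nat.card (BeltCell (A v)))
      (m' := Nat.card (BeltCell (A u))) (t := (Finite.equivFin (BeltCell (A v)) c : ℕ))
      (t' := (Finite.equivFin (BeltCell (A u)) d : ℕ)) (δ := if c.1 true = c.2 then 1 else 0)
      (δ' := if d.1 true = d.2 then 1 else 0) (s := s) (by omega) (by omega) (by omega) (by omega)
      (by omega) (by omega) hs hs' fun k h₁ h₂ h₃ => iff_of_ite_eq_ite hne (h k h₁ h₂ h₃)
    exact ⟨this.1, hrank (by exact_mod_cast this.2)⟩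
  code_injective {v c d} h := by
    have hc := (Finite.equivFin _ c).2
    have := (iff_of_ite_eq_ite hne (h (2 * (rank v + 1 +
      (Finite.equivFin (BeltCell (A v)) c : ℕ)) + 3) (by omega) (by omega))).mp
        (Or.inr (Or.inr (Or.inr (Or.inl rfl))))
    refine (Finite.equivFin _).injective (Fin.ext ?_)
    unfold IsCodeOne at this
    omega

end code

/-! ### Change of alphabet. -/

section alphabets

variable {A A' : Type*} [TopologicalSpace A] [TopologicalSpace A']

/-- A homeomorphism of alphabets induces an isomorphism of the automorphism groups of the full
shifts. -/
def FullShiftAut.mapAlphabet (e : A ≃ₜ A') : FullShiftAut A →* FullShiftAut A' where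
  toFun f := ⟨((Homeomorph.piCongrRight fun _ : ℤ => e).symm.trans f.1).trans
    (Homeomorph.piCongrRight fun _ : ℤ => e), fun x => by
      change (fun i => e (f.1 (SymbolicDynamics.FullShift.shift 1 fun j => e.symm (x j)) i)) = _
      rw [f.2]
      rfl⟩
  map_one' := Subtype.ext (Homeomorph.ext fun x => funext fun i => e.apply_symm_apply (x i))
  map_mul' f g := Subtype.ext (Homeomorph.ext fun x => funext fun i => by
    change e (f.1 (g.1 fun j => e.symm (x j)) i) =
      e (f.1 (fun j => e.symm (e (g.1 (fun j => e.symm (x j)) j))) i)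
    simp only [Homeomorph.symm_apply_apply])

theorem FullShiftAut.mapAlphabet_injective (e : A ≃ₜ A') :
    Function.Injective (FullShiftAut.mapAlphabet e) := by
  refine (injective_iff_map_eq_one _).mpr fun f hf => Subtype.ext (Homeomorph.ext fun x => ?_)
  have h := congrArg (fun g : FullShiftAut A' => g.1 fun j => e (x j)) hf
  funext i
  have := congrFun h i
  change e (f.1 (fun j => e.symm (e (x j))) i) = e (x i) at this
  simp only [Homeomorph.symm_apply_apply] at this
  exact e.injective this

/-- Cells need nonempty alphabets. Over the empty alphabet there are no configurations, so the group
is trivial and embeds over `Fin 1`. -/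
theorem EmbedsInFullShiftAut.exists_fin [Finite A] [DiscreteTopology A] {G : Type*} [Group G]
    (h : EmbedsInFullShiftAut A G) : ∃ n : ℕ, EmbedsInFullShiftAut (Fin (n + 1)) G := by
  obtain ⟨φ, hφ⟩ := h
  rcases isEmpty_or_nonempty A with hA | hA
  · have : Subsingleton (FullShiftAut A) :=
      ⟨fun f g => Subtype.ext (Homeomorph.ext fun x => (hA.false (x 0)).elim)⟩
    have : Subsingleton G := hφ.subsingleton
    exact ⟨0, 1, Function.injective_of_subsingleton _⟩
  · obtain ⟨n, hn⟩ := Nat.exists_eq_succ_of_ne_zero (Nat.card_pos (α := A)).ne'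
    let e : A ≃ₜ Fin (n + 1) :=
      { (Finite.equivFin A).trans (finCongr hn) with
        continuous_toFun := continuous_of_discreteTopology
        continuous_invFun := continuous_of_discreteTopology }
    exact ⟨n, (FullShiftAut.mapAlphabet e).comp φ,
      (FullShiftAut.mapAlphabet_injective e).comp hφ⟩

end alphabets

/-! ### Graph products: reduced representatives and the universal property. -/

namespace GraphProduct

variable {V : Type*} {Γ : SimpleGraph V} {G : V → Type*} [∀ v, Group (G v)]

variable (Γ G) in
/-- The projection from the free product to the graph product. -/
def mk : Monoid.CoprodI G →* GraphProduct Γ G :=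
  QuotientGroup.mk' (Subgroup.normalClosure (graphProductRelators Γ G))

variable (Γ) in
/-- The canonical homomorphism from a node group to the graph product. -/
def of (v : V) : G v →* GraphProduct Γ G :=
  (mk Γ G).comp Monoid.CoprodI.of

theorem commute_of {u v : V} (h : Γ.Adj u v) (a : G u) (b : G v) :
    Commute (of Γ u a : GraphProduct Γ G) (of Γ v b) := by
  refine commutatorElement_eq_one_iff_commute.mp ?_
  rw [of, of, MonoidHom.comp_apply, MonoidHom.comp_apply, ← map_commutatorElement]
  exact (QuotientGroup.eq_one_iff _).mpr (Subgroup.subset_normalClosure ⟨u, v, h, a, b, rfl⟩)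

variable (Γ) in
/-- The element of the graph product represented by a word in the node groups. -/
def wordProd (l : List (Σ v, G v)) : GraphProduct Γ G := (l.map fun s => of Γ s.1 s.2).prod

theorem wordProd_append (l l' : List (Σ v, G v)) :
    wordProd Γ (l ++ l') = wordProd Γ l * wordProd Γ l' := by
  rw [wordProd, List.map_append, List.prod_append, wordProd, wordProd]

theorem wordProd_cons (s : Σ v, G v) (l : List (Σ v, G v)) :
    wordProd Γ (s :: l) = of Γ s.1 s.2 * wordProd Γ l := by
  rw [wordProd, List.map_cons, List.prod_cons, wordProd]

theorem exists_wordProd_eq (h : GraphProduct Γ G) : ∃ l, wordProd Γ l = h := by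
  obtain ⟨x, rfl⟩ : ∃ x, mk Γ G x = h := QuotientGroup.mk'_surjective _ h
  induction x using Monoid.CoprodI.induction_on with
  | one => exact ⟨[], rfl⟩
  | of v a => exact ⟨[⟨v, a⟩], mul_one _⟩
  | mul x y hx hy =>
    obtain ⟨l, hl⟩ := hx
    obtain ⟨l', hl'⟩ := hy
    exact ⟨l ++ l', by rw [wordProd_append, hl, hl', map_mul]⟩

theorem commute_wordProd {v : V} (a : G v) {r : List (Σ v, G v)} (hr : ∀ t ∈ r, Γ.Adj t.1 v) :
    Commute (wordProd Γ r) (of Γ v a) := by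
  refine Commute.list_prod_left _ _ fun x hx => ?_
  obtain ⟨t, ht, rfl⟩ := List.mem_map.mp hx
  exact commute_of (hr t ht) _ _

/-- Every element of a graph product is represented by a reduced word without trivial syllables. -/
theorem exists_reduced_wordProd_eq (h : GraphProduct Γ G) :
    ∃ l, wordProd Γ l = h ∧ Γ.IsReducedWord (l.map Sigma.fst) ∧ ∀ s ∈ l, s.2 ≠ 1 := by
  classical
  have hex : ∃ n, ∃ l, wordProd Γ l = h ∧ l.length = n :=
    (exists_wordProd_eq h).elim fun l hl => ⟨_, l, hl, rfl⟩
  obtain ⟨l, hl, hlen⟩ := Nat.find_spec hex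
  have hmin : ∀ l', wordProd Γ l' = h → l.length ≤ l'.length := fun l' hl' =>
    hlen ▸ Nat.find_min' hex ⟨l', hl', rfl⟩
  refine ⟨l, hl, fun a v r b e => ?_, fun s hs h₁ => ?_⟩
  · by_contra! hadj
    obtain ⟨a, l₁, rfl, rfl, e₁⟩ := List.map_eq_append_iff.mp e
    obtain ⟨⟨v, g⟩, l₂, rfl, rfl, e₂⟩ := List.map_eq_cons_iff.mp e₁
    obtain ⟨r, l₃, rfl, rfl, e₃⟩ := List.map_eq_append_iff.mp e₂
    obtain ⟨⟨w, g'⟩, b, rfl, hw, rfl⟩ := List.map_eq_cons_iff.mp e₃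
    obtain rfl : w = v := hw
    -- A representative of minimal length is reduced: otherwise the second syllable of type `w`
    -- could be moved left past `r` and merged with the first.
    have := hmin (a ++ ⟨w, g * g'⟩ :: (r ++ b)) (by
      rw [← hl]
      simp only [wordProd_append, wordProd_cons, map_mul]
      rw [← mul_assoc (wordProd Γ r),
        (commute_wordProd g' fun t ht => hadj _ (List.mem_map_of_mem ht)).eq]
      simp only [mul_assoc])
    simp at this
  · obtain ⟨a, b, rfl⟩ := List.append_of_mem hs
    have := hmin (a ++ b) (by
      rw [← hl, wordProd_append, wordProd_append, wordProd_cons, h₁, map_one, one_mul])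
    simp at this

variable {H : Type*} [Group H]

/-- The universal property of the graph product. -/
def lift (φ : ∀ v, G v →* H) (hφ : ∀ u v, Γ.Adj u v → ∀ a b, Commute (φ u a) (φ v b)) :
    GraphProduct Γ G →* H :=
  QuotientGroup.lift _ (Monoid.CoprodI.lift φ) <| by
    refine Subgroup.normalClosure_le_normal ?_
    rintro _ ⟨u, v, h, a, b, rfl⟩
    change Monoid.CoprodI.lift φ _ = 1
    rw [map_commutatorElement, Monoid.CoprodI.lift_of, Monoid.CoprodI.lift_of]
    exact commutatorElement_eq_one_iff_commute.mpr (hφ u v h a b)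

theorem lift_wordProd (φ : ∀ v, G v →* H)
    (hφ : ∀ u v, Γ.Adj u v → ∀ a b, Commute (φ u a) (φ v b)) (l : List (Σ v, G v)) :
    lift φ hφ (wordProd Γ l) = (l.map fun s => φ s.1 s.2).prod := by
  rw [wordProd, map_list_prod, List.map_map]
  exact congrArg List.prod (List.map_congr_left fun s _ => Monoid.CoprodI.lift_of φ s.2)

end GraphProduct

/-! ### The embedding of the graph product. -/

theorem theorem1 {V : Type*} [Countable V] (Γ : SimpleGraph V)
    (G : V → Type*) [∀ v, Group (G v)]
    (A : V → Type*) [∀ v, Finite (A v)] [∀ v, TopologicalSpace (A v)]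
    [∀ v, DiscreteTopology (A v)]
    (hG : ∀ v, EmbedsInFullShiftAut (A v) (G v))
    (B : Type*) [Finite B] [Nontrivial B] [TopologicalSpace B] [DiscreteTopology B] :
    EmbedsInFullShiftAut B (GraphProduct Γ G) := by
  obtain ⟨rank, hrank⟩ := exists_injective_nat V
  obtain ⟨on, off, hne⟩ := exists_pair_ne B
  choose n φ hφ using fun v => (hG v).exists_fin
  let κ : CellCode V (fun v => Fin (n v + 1)) B := CellCode.ofInjective rank hrank on off hne
  let Ψ : GraphProduct Γ G →* FullShiftAut B :=
    GraphProduct.lift (fun v => (κ.beltHom Γ v).comp (φ v)) fun _ _ h _ _ =>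
      CellCode.commute_beltHom h _ _
  refine ⟨Ψ, (injective_iff_map_eq_one Ψ).mpr fun h hh => ?_⟩
  obtain ⟨l, rfl, hred, h₁⟩ := GraphProduct.exists_reduced_wordProd_eq h
  rcases eq_or_ne l [] with rfl | hl
  · rfl
  · refine (CellCode.wordAct_ne_one (κ := κ) (Γ := Γ)
      (l := l.map fun s => ⟨s.1, φ s.1 s.2⟩) ?_ ?_ (by simpa using hl) ?_).elim
    · rw [List.map_map]
      exact hred
    · intro s hs
      obtain ⟨t, ht, rfl⟩ := List.mem_map.mp hs
      exact fun e => h₁ t ht ((injective_iff_map_eq_one _).mp (hφ t.1) _ e)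
    · rw [GraphProduct.lift_wordProd] at hh
      rw [CellCode.wordAct, List.map_map]
      exact hh
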